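/- Let $y=y_n\in\mathbb{R}^n$ be the data with true distribution $P_n^0$, $S_n:\mathbb{R}^n\to\mathbb{R}^d$ measurable summary statistics (we also write $S_n$ for $S_n(y)$), $\Theta\subseteq\mathbb{R}^{d_\theta}$ a measurable parameter set with prior density $\pi$ on $\Theta$, $b:\Theta\to\mathbb{R}^d$ a known map, and $A_n(\theta)$, $\theta\in\Theta$, possibly random $d\times d$ matrices, jointly measurable in the randomness and $\theta$. The idealized synthetic likelihood is the normal density $g_n(S_n\mid\theta)=N\{S_n;b(\theta),A_n(\theta)^\intercal A_n(\theta)\}$, the posterior density is $\pi(\theta\mid S_n)=g_n(S_n\mid\theta)\pi(\theta)/\int_\Theta g_n(S_n\mid\theta')\pi(\theta')\,d\theta'$, and $\hat\theta=\int_\Theta\theta\,\pi(\theta\mid S_n)\,d\theta$ is the posterior mean. Assume: 1. There are positive reals $v_n\to\infty$ and $b_0\in\mathbb{R}^d$ such that $V_0=\lim_n\mathrm{var}\{v_n(S_n-b_0)\}$ exists and $v_n(S_n-b_0)\Rightarrow N(0,V_0)$ under $P_n^0$. 2. (i) There are constants $0<c_1\le c_2<\infty$ such that for every $\theta\in\Theta$,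 with probability tending to one, all eigenvalues of $v_n^2A_n(\theta)^\intercal A_n(\theta)$ lie in $[c_1,c_2]$. (ii) There is a uniformly continuous matrix function $B$ on $\Theta$ with $B(\theta)^\intercal B(\theta)$ positive definite for all $\theta\in\Theta$ and $\sup_{\theta\in\Theta}\|v_n^2A_n(\theta)^\intercal A_n(\theta)-B(\theta)^\intercal B(\theta)\|=o_p(1)$. 3. (i) $b$ is continuous and injective on $\Theta$, there is $\theta_0$ in the interior of $\Theta$ with $b(\theta_0)=b_0$, and $\theta_0$ is identified by $b$ in the sense that the inverse of $b$ is continuous at $b_0$: for every $\delta>0$, $\inf\{|b(\theta)-b_0|:\theta\in\Theta,\ |\theta-\theta_0|\ge\delta\}>0$ (this is automatic when $\Theta$ is compact, and when $d=d_\theta$). (ii) For some $\delta>0$, $b$ is differentiable with continuous Jacobian $\nabla b(\theta)$ on $|\theta-\theta_0|\le\delta$, and $\nabla b(\theta_0)$ has full column rank $d_\theta$. 4. $\pi(\theta_0)>0$, and $\pi$ is continuous on $|\theta-\theta_0|\le\delta$ for some $\delta>0$. 5. $\int_\Theta|\theta|\,\pi(\theta)\,d\theta<\infty$. Then, with probability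 tending to one, the posterior is well defined (its normalizing constant is finite and positive) and has a finite mean, and, under $P_n^0$, $$v_n(\hat\theta-\theta_0)\Rightarrow N\left[0,\;W_0^{-1}\left\{\nabla b(\theta_0)^\intercal(B_0^\intercal B_0)^{-1}V_0(B_0^\intercal B_0)^{-1}\nabla b(\theta_0)\right\}W_0^{-1}\right],$$ where $B_0=B(\theta_0)$ and $W_0=\nabla b(\theta_0)^\intercal(B_0^\intercal B_0)^{-1}\nabla b(\theta_0)$. -/

import Mathlib

open MeasureTheory ProbabilityTheory Filter Topology Matrix
open scoped ENNReal

noncomputable section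

namespace SynthLik

/-- `ℝᵏ` with its Euclidean norm. -/
abbrev Vec (k : ℕ) : Type := EuclideanSpace ℝ (Fin k)

/-- The normal density `N(x; μ, Σ)` on `ℝᵈ` (for `Σ` positive definite). -/
def normalDensity {d : ℕ} (x μ : Vec d) (Sig : Matrix (Fin d) (Fin d) ℝ) : ℝ :=
  (√((2 * Real.pi) ^ d * Sig.det))⁻¹ *
    Real.exp (-(1 / 2) * ((x - μ).ofLp ⬝ᵥ (Sig⁻¹ *ᵥ (x - μ).ofLp)))

/-- The synthetic likelihood `g(s | θ) = N{s; b(θ), A(θ)ᵀ A(θ)}`. -/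
def synLik {d p : ℕ} (b : Vec p → Vec d) (A : Vec p → Matrix (Fin d) (Fin d) ℝ)
    (s : Vec d) (θ : Vec p) : ℝ :=
  normalDensity s (b θ) ((A θ)ᵀ * A θ)

/-- The normalizing constant `∫_Θ g(s | θ) π(θ) dθ`. -/
def evidence {d p : ℕ} (Θ : Set (Vec p)) (prior : Vec p → ℝ) (b : Vec p → Vec d)
    (A : Vec p → Matrix (Fin d) (Fin d) ℝ) (s : Vec d) : ℝ :=
  ∫ θ in Θ, synLik b A s θ * prior θ

/-- The idealized synthetic likelihood posterior density
`π(θ | s) = g(s | θ) π(θ) / ∫_Θ g(s | θ') π(θ') dθ'` on `Θ`. -/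
def posteriorDensity {d p : ℕ} (Θ : Set (Vec p)) (prior : Vec p → ℝ) (b : Vec p → Vec d)
    (A : Vec p → Matrix (Fin d) (Fin d) ℝ) (s : Vec d) (θ : Vec p) : ℝ :=
  synLik b A s θ * prior θ / evidence Θ prior b A s

/-- The posterior mean `∫_Θ θ π(θ | s) dθ`. -/
def posteriorMean {d p : ℕ} (Θ : Set (Vec p)) (prior : Vec p → ℝ) (b : Vec p → Vec d)
    (A : Vec p → Matrix (Fin d) (Fin d) ℝ) (s : Vec d) : Vec p :=
  ∫ θ in Θ, posteriorDensity Θ prior b A s θ • θ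

/-- The posterior is well defined (its normalizing constant is a convergent, positive
integral) and has a finite mean. -/
def PosteriorMeanExists {d p : ℕ} (Θ : Set (Vec p)) (prior : Vec p → ℝ) (b : Vec p → Vec d)
    (A : Vec p → Matrix (Fin d) (Fin d) ℝ) (s : Vec d) : Prop :=
  IntegrableOn (fun θ => synLik b A s θ * prior θ) Θ ∧
  0 < evidence Θ prior b A s ∧
  IntegrableOn (fun θ => posteriorDensity Θ prior b A s θ • θ) Θ

/-- The Jacobian matrix `∇b(θ)`, with entries `∂ b_i / ∂ θ_j`. -/
def jacobian {d p : ℕ} (b : Vec p → Vec d) (θ : Vec p) : Matrix (Fin d) (Fin p) ℝ :=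
  Matrix.of fun i j => (fderiv ℝ b θ (EuclideanSpace.single j 1)) i

/-- The covariance matrix `var(X)` of a random vector. -/
def varMatrix {Ω : Type*} [MeasurableSpace Ω] {d : ℕ} (X : Ω → Vec d) (P : Measure Ω) :
    Matrix (Fin d) (Fin d) ℝ :=
  Matrix.of fun i j => cov[fun ω => X ω i, fun ω => X ω j; P]

/-- A sequence of `[0, ∞]`-valued random quantities is `o_p(1)`. Each may live on its own
probability space; for non-measurable ones (such as an uncountable supremum) this is
convergence to zero in outer probability. -/
def IsLittleOP {Ω : ℕ → Type*} [∀ n, MeasurableSpace (Ω n)] (P : ∀ n, Measure (Ω n))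
    (X : ∀ n, Ω n → ℝ≥0∞) : Prop :=
  ∀ ε : ℝ≥0∞, 0 < ε → Tendsto (fun n => P n {ω | ε ≤ X n ω}) atTop (𝓝 0)

/-- All eigenvalues of the symmetric matrix `M` lie in `[c₁, c₂]`. -/
def EigenvaluesIn {d : ℕ} (c₁ c₂ : ℝ) (M : Matrix (Fin d) (Fin d) ℝ) : Prop :=
  ∀ x : Fin d → ℝ, c₁ * (x ⬝ᵥ x) ≤ x ⬝ᵥ (M *ᵥ x) ∧ x ⬝ᵥ (M *ᵥ x) ≤ c₂ * (x ⬝ᵥ x)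

/-- The prior: a measurable probability density on the measurable set `Θ ⊆ ℝᵖ`. -/
structure IsPriorDensity {p : ℕ} (Θ : Set (Vec p)) (prior : Vec p → ℝ) : Prop where
  measurableSet : MeasurableSet Θ
  measurable : Measurable prior
  nonneg : ∀ θ ∈ Θ, 0 ≤ prior θ
  integral_eq_one : ∫ θ in Θ, prior θ = 1

/-- Central limit theorem for the summaries: `vₙ > 0` diverges, `V₀ = lim var{vₙ (Sₙ - b₀)}`
exists and `vₙ (Sₙ - b₀) ⇒ N(0, V₀)`. Here `T n` is the random vector `Sₙ(y)`. -/
structure SummaryCLT {Ω : ℕ → Type*} [∀ n, MeasurableSpace (Ω n)] (P : ∀ n, Measure (Ω n))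
    [∀ n, IsProbabilityMeasure (P n)] {d : ℕ} (T : ∀ n, Ω n → Vec d) (v : ℕ → ℝ)
    (b₀ : Vec d) (V₀ : Matrix (Fin d) (Fin d) ℝ) : Prop where
  rate_pos : ∀ n, 0 < v n
  rate_tendsto : Tendsto v atTop atTop
  memLp : ∀ᶠ n in atTop, MemLp (T n) 2 (P n)
  var_tendsto : Tendsto (fun n => varMatrix (fun ω => v n • (T n ω - b₀)) (P n)) atTop (𝓝 V₀)
  clt : TendstoInDistribution (fun n ω => v n • (T n ω - b₀)) atTop
    (id : Vec d → Vec d) P (multivariateGaussian 0 V₀)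

open scoped Matrix.Norms.L2Operator in
/-- Conditions on the possibly random matrices `Aₙ(θ)` and on their limit `B(θ)`. -/
structure CovarianceConditions {Ω : ℕ → Type*} [∀ n, MeasurableSpace (Ω n)]
    (P : ∀ n, Measure (Ω n)) {d p : ℕ} (Θ : Set (Vec p)) (v : ℕ → ℝ)
    (A : ∀ n, Ω n → Vec p → Matrix (Fin d) (Fin d) ℝ)
    (B : Vec p → Matrix (Fin d) (Fin d) ℝ) : Prop where
  measurable : ∀ n i j, Measurable (fun x : Ω n × Vec p => A n x.1 x.2 i j)
  eigenvalues : ∃ c₁ c₂ : ℝ, 0 < c₁ ∧ c₁ ≤ c₂ ∧ ∀ θ ∈ Θ,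
    Tendsto (fun n => P n {ω | ¬ EigenvaluesIn c₁ c₂ (v n ^ 2 • ((A n ω θ)ᵀ * A n ω θ))})
      atTop (𝓝 0)
  posDef : ∀ θ ∈ Θ, ((B θ)ᵀ * B θ).PosDef
  uniformContinuousOn : UniformContinuousOn B Θ
  uniform_tendsto : IsLittleOP P
    (fun n ω => ⨆ θ ∈ Θ, ‖v n ^ 2 • ((A n ω θ)ᵀ * A n ω θ) - (B θ)ᵀ * B θ‖ₑ)

/-- Conditions on the map `b`: continuity and injectivity on `Θ`, `θ₀` interior with
`b(θ₀) = b₀`, identification of `θ₀` (the inverse of `b` is continuous at `b₀`), and a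
continuous Jacobian near `θ₀` that has full column rank at `θ₀`. -/
structure MeanMapConditions {d p : ℕ} (Θ : Set (Vec p)) (b : Vec p → Vec d) (θ₀ : Vec p)
    (b₀ : Vec d) : Prop where
  continuousOn : ContinuousOn b Θ
  injOn : Set.InjOn b Θ
  mem_interior : θ₀ ∈ interior Θ
  map_eq : b θ₀ = b₀
  identified : ∀ δ : ℝ, 0 < δ → ∃ ε : ℝ, 0 < ε ∧ ∀ θ ∈ Θ, ‖b θ - b₀‖ < ε → ‖θ - θ₀‖ < δ
  jacobian_continuous : ∃ δ : ℝ, 0 < δ ∧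
    (∀ θ ∈ Metric.closedBall θ₀ δ, DifferentiableAt ℝ b θ) ∧
    ContinuousOn (jacobian b) (Metric.closedBall θ₀ δ)
  full_rank : (jacobian b θ₀).rank = p

/-- The prior density is positive at `θ₀` and continuous near `θ₀`. -/
structure PriorConditions {p : ℕ} (prior : Vec p → ℝ) (θ₀ : Vec p) : Prop where
  pos : 0 < prior θ₀
  continuous_near : ∃ δ : ℝ, 0 < δ ∧ ContinuousOn prior (Metric.closedBall θ₀ δ)

/-- `W₀ = ∇bᵀ (B₀ᵀ B₀)⁻¹ ∇b`, with `J = ∇b(θ₀)`. -/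
def W {d p : ℕ} (J : Matrix (Fin d) (Fin p) ℝ) (B₀ : Matrix (Fin d) (Fin d) ℝ) :
    Matrix (Fin p) (Fin p) ℝ :=
  Jᵀ * (B₀ᵀ * B₀)⁻¹ * J

/-- The sandwich covariance
`W₀⁻¹ {∇bᵀ (B₀ᵀ B₀)⁻¹ V₀ (B₀ᵀ B₀)⁻¹ ∇b} W₀⁻¹`. -/
def sandwich {d p : ℕ} (J : Matrix (Fin d) (Fin p) ℝ) (B₀ V₀ : Matrix (Fin d) (Fin d) ℝ) :
    Matrix (Fin p) (Fin p) ℝ :=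
  (W J B₀)⁻¹ * (Jᵀ * (B₀ᵀ * B₀)⁻¹ * V₀ * (B₀ᵀ * B₀)⁻¹ * J) * (W J B₀)⁻¹

end SynthLik

end

namespace SynthLik

/-- The unnormalized centred normal density `det(M)^{-1/2} exp(-zᵀ M⁻¹ z / 2)`. -/
noncomputable def gaussKernel {d : ℕ} (M : Matrix (Fin d) (Fin d) ℝ) (z : Vec d) : ℝ :=
  (√M.det)⁻¹ * Real.exp (-(1 / 2) * (z.ofLp ⬝ᵥ (M⁻¹ *ᵥ z.ofLp)))

lemma ofLp_dotProduct_self {d : ℕ} (z : Vec d) : z.ofLp ⬝ᵥ z.ofLp = ‖z‖ ^ 2 := by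
  rw [EuclideanSpace.real_norm_sq_eq]
  simp [dotProduct, sq]

lemma EigenvaluesIn.posDef {d : ℕ} {c₁ c₂ : ℝ} {M : Matrix (Fin d) (Fin d) ℝ}
    (h : EigenvaluesIn c₁ c₂ M) (hM : M.IsHermitian) (hc : 0 < c₁) : M.PosDef := by
  refine Matrix.PosDef.of_dotProduct_mulVec_pos hM fun x hx => ?_
  have hx' : 0 < x ⬝ᵥ x := by
    have := dotProduct_star_self_pos_iff.2 hx
    simpa using this
  simpa using (mul_pos hc hx').trans_le (h x).1

lemma EigenvaluesIn.det_ge {d : ℕ} {c₁ c₂ : ℝ} {M : Matrix (Fin d) (Fin d) ℝ}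
    (h : EigenvaluesIn c₁ c₂ M) (hM : M.IsHermitian) (hc : 0 < c₁) : c₁ ^ d ≤ M.det := by
  rw [hM.det_eq_prod_eigenvalues]
  have key : ∀ i, c₁ ≤ hM.eigenvalues i := fun i => by
    have h1 := (h (hM.eigenvectorBasis i).ofLp).1
    rw [ofLp_dotProduct_self, hM.eigenvectorBasis.orthonormal.1 i] at h1
    rw [hM.eigenvalues_eq i]
    simpa using h1
  simpa using Finset.prod_le_prod (s := Finset.univ) (f := fun _ : Fin d => c₁)
    (g := fun i => hM.eigenvalues i) (fun _ _ => hc.le) (fun i _ => key i)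

lemma PosDef.cauchySchwarz {d : ℕ} {M : Matrix (Fin d) (Fin d) ℝ} (hM : M.PosSemidef)
    (x y : Fin d → ℝ) :
    (x ⬝ᵥ (M *ᵥ y)) ^ 2 ≤ (x ⬝ᵥ (M *ᵥ x)) * (y ⬝ᵥ (M *ᵥ y)) := by
  have hs : y ⬝ᵥ (M *ᵥ x) = x ⬝ᵥ (M *ᵥ y) := by
    have hT : Mᵀ = M := (conjTranspose_eq_transpose_of_trivial M).symm.trans hM.1.eq
    rw [dotProduct_mulVec, ← mulVec_transpose, hT, dotProduct_comm]
  have h := discrim_le_zero (a := y ⬝ᵥ (M *ᵥ y)) (b := 2 * (x ⬝ᵥ (M *ᵥ y)))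
    (c := x ⬝ᵥ (M *ᵥ x)) fun t => by
      have h0 := hM.dotProduct_mulVec_nonneg (x + t • y)
      simp only [star_trivial, mulVec_add, mulVec_smul, dotProduct_add, add_dotProduct,
        smul_dotProduct, dotProduct_smul, smul_eq_mul, hs] at h0
      linarith
  rw [discrim] at h
  linarith

lemma EigenvaluesIn.inv_form_ge {d : ℕ} {c₁ c₂ : ℝ} {M : Matrix (Fin d) (Fin d) ℝ}
    (h : EigenvaluesIn c₁ c₂ M) (hM : M.IsHermitian) (hc : 0 < c₁) (z : Fin d → ℝ) :
    z ⬝ᵥ z ≤ c₂ * (z ⬝ᵥ (M⁻¹ *ᵥ z)) := by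
  have hP := h.posDef hM hc
  have hu : IsUnit M.det := hP.det_pos.ne'.isUnit
  set w := M⁻¹ *ᵥ z with hw
  have hz : M *ᵥ w = z := by rw [hw, mulVec_mulVec, mul_nonsing_inv _ hu, one_mulVec]
  have h1 := PosDef.cauchySchwarz hP.posSemidef z w
  rw [hz] at h1
  have h2 := (h z).2
  have h0 : 0 ≤ z ⬝ᵥ z := by simpa using dotProduct_star_self_nonneg z
  have h3 : 0 ≤ z ⬝ᵥ w := by
    have := hP.inv.posSemidef.dotProduct_mulVec_nonneg z
    simpa using this
  rw [dotProduct_comm w z] at h1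
  rcases h0.eq_or_lt with h4 | h4
  · have : z = 0 := by
      have := h4.symm
      simpa [dotProduct_self_eq_zero] using this
    simp [this]
  · have h5 : (z ⬝ᵥ z) * (z ⬝ᵥ z) ≤ (z ⬝ᵥ z) * (c₂ * (z ⬝ᵥ w)) := by
      nlinarith [mul_le_mul_of_nonneg_right h2 h3]
    exact le_of_mul_le_mul_left h5 h4

lemma EigenvaluesIn.gaussKernel_le {d : ℕ} {c₁ c₂ : ℝ} {M : Matrix (Fin d) (Fin d) ℝ}
    (h : EigenvaluesIn c₁ c₂ M) (hM : M.IsHermitian) (hc : 0 < c₁) (hc₂ : 0 < c₂) (z : Vec d) :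
    gaussKernel M z ≤ (√(c₁ ^ d))⁻¹ * Real.exp (-(1 / (2 * c₂)) * ‖z‖ ^ 2) := by
  have h1 := h.inv_form_ge hM hc z.ofLp
  rw [ofLp_dotProduct_self] at h1
  have h2 := h.det_ge hM hc
  unfold gaussKernel
  have h3 : ‖z‖ ^ 2 / c₂ ≤ z.ofLp ⬝ᵥ (M⁻¹ *ᵥ z.ofLp) := by
    rw [div_le_iff₀ hc₂]; linarith
  have h4 : -(1 / 2) * (z.ofLp ⬝ᵥ (M⁻¹ *ᵥ z.ofLp)) ≤ -(1 / (2 * c₂)) * ‖z‖ ^ 2 := by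
    have : (1 / (2 * c₂)) * ‖z‖ ^ 2 = (1 / 2) * (‖z‖ ^ 2 / c₂) := by field_simp
    linarith
  have h5 : 0 < √(c₁ ^ d) := by positivity
  gcongr

lemma gaussKernel_nonneg {d : ℕ} (M : Matrix (Fin d) (Fin d) ℝ) (z : Vec d) :
    0 ≤ gaussKernel M z := by
  unfold gaussKernel; positivity

lemma gaussKernel_pos {d : ℕ} {M : Matrix (Fin d) (Fin d) ℝ} (hM : 0 < M.det) (z : Vec d) :
    0 < gaussKernel M z := by
  unfold gaussKernel
  have := Real.sqrt_pos.2 hM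
  positivity

lemma gaussKernel_eq_adjugate {d : ℕ} (M : Matrix (Fin d) (Fin d) ℝ) (z : Vec d) :
    gaussKernel M z =
      (√M.det)⁻¹ * Real.exp (-(1 / 2) * (M.det⁻¹ * (z.ofLp ⬝ᵥ (M.adjugate *ᵥ z.ofLp)))) := by
  rw [gaussKernel, Matrix.inv_def, Ring.inverse_eq_inv', smul_mulVec, dotProduct_smul, smul_eq_mul]

lemma tendsto_gaussKernel {ι : Type*} {l : Filter ι} {d : ℕ}
    {M : ι → Matrix (Fin d) (Fin d) ℝ} {M₀ : Matrix (Fin d) (Fin d) ℝ} {z : ι → Vec d} {z₀ : Vec d}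
    (hM : Tendsto M l (𝓝 M₀)) (hz : Tendsto z l (𝓝 z₀)) (h0 : 0 < M₀.det) :
    Tendsto (fun i => gaussKernel (M i) (z i)) l (𝓝 (gaussKernel M₀ z₀)) := by
  simp only [gaussKernel_eq_adjugate]
  have hdet : Tendsto (fun i => (M i).det) l (𝓝 M₀.det) :=
    (Continuous.matrix_det continuous_id).continuousAt.tendsto.comp hM
  have hform : Tendsto (fun i => (z i).ofLp ⬝ᵥ ((M i).adjugate *ᵥ (z i).ofLp)) l
      (𝓝 (z₀.ofLp ⬝ᵥ (M₀.adjugate *ᵥ z₀.ofLp))) := by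
    have hc : Continuous fun q : Matrix (Fin d) (Fin d) ℝ × Vec d =>
        q.2.ofLp ⬝ᵥ (q.1.adjugate *ᵥ q.2.ofLp) := by fun_prop
    exact hc.continuousAt.tendsto.comp (hM.prodMk_nhds hz)
  exact ((hdet.sqrt).inv₀ (Real.sqrt_pos.2 h0).ne').mul
    ((Real.continuous_exp.tendsto _).comp (((hdet.inv₀ h0.ne').mul hform).const_mul _))

lemma measurable_gaussKernel {α : Type*} [MeasurableSpace α] {d : ℕ}
    {M : α → Matrix (Fin d) (Fin d) ℝ} {z : α → Vec d}
    (hM : ∀ i j, Measurable fun a => M a i j) (hz : Measurable z) :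
    Measurable fun a => gaussKernel (M a) (z a) := by
  simp only [gaussKernel_eq_adjugate]
  have hM' : Measurable (fun a => (fun i j => M a i j : Fin d → Fin d → ℝ)) :=
    measurable_pi_iff.2 fun i => measurable_pi_iff.2 fun j => hM i j
  have hdet : Measurable fun a => (M a).det := by
    have hc : Continuous fun q : Fin d → Fin d → ℝ => (Matrix.of q).det := by
      fun_prop
    exact hc.measurable.comp hM'
  have hform : Measurable fun a => (z a).ofLp ⬝ᵥ ((M a).adjugate *ᵥ (z a).ofLp) := by
    have hc : Continuous fun q : (Fin d → Fin d → ℝ) × Vec d =>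
        q.2.ofLp ⬝ᵥ ((Matrix.of q.1).adjugate *ᵥ q.2.ofLp) := by
      fun_prop
    exact hc.measurable.comp (hM'.prodMk hz)
  exact hdet.sqrt.inv.mul (Real.measurable_exp.comp ((hdet.inv.mul hform).const_mul _))

lemma synLik_eq_gaussKernel {d p : ℕ} (b : Vec p → Vec d) (A : Vec p → Matrix (Fin d) (Fin d) ℝ)
    (s : Vec d) (θ : Vec p) {v : ℝ} (hv : 0 < v) :
    synLik b A s θ = (√((2 * Real.pi) ^ d))⁻¹ * v ^ d *
      gaussKernel (v ^ 2 • ((A θ)ᵀ * A θ)) (v • (s - b θ)) := by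
  unfold synLik normalDensity
  rw [gaussKernel_eq_adjugate, Matrix.inv_def, Ring.inverse_eq_inv', smul_mulVec, dotProduct_smul,
    smul_eq_mul]
  set S := (A θ)ᵀ * A θ
  rw [Real.sqrt_mul (by positivity), det_smul, Fintype.card_fin]
  have h1 : √((v ^ 2) ^ d * S.det) = v ^ d * √S.det := by
    rw [Real.sqrt_mul (by positivity), ← pow_mul, mul_comm 2 d, pow_mul, Real.sqrt_sq (by positivity)]
  have h2 : ((v ^ 2) ^ d * S.det)⁻¹ *
      ((v • (s - b θ)).ofLp ⬝ᵥ ((v ^ 2 • S).adjugate *ᵥ (v • (s - b θ)).ofLp)) =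
      S.det⁻¹ * ((s - b θ).ofLp ⬝ᵥ (S.adjugate *ᵥ (s - b θ).ofLp)) := by
    have hd : v ≠ 0 := hv.ne'
    rcases Nat.eq_zero_or_pos d with rfl | hpos
    · simp [dotProduct]
    rw [adjugate_smul, Fintype.card_fin]
    simp only [WithLp.ofLp_smul, mulVec_smul, smul_mulVec, dotProduct_smul, smul_dotProduct, smul_eq_mul]
    obtain ⟨m, rfl⟩ : ∃ m, d = m + 1 := ⟨d - 1, by omega⟩
    simp only [Nat.add_sub_cancel]
    field_simp
    ring
  rw [h1, h2]
  have : v ^ d ≠ 0 := by positivity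
  field_simp

end SynthLik

namespace SynthLik

lemma one_add_le_exp_sq {c : ℝ} (hc : 0 < c) (r : ℝ) :
    1 + r ≤ Real.exp (1 / (2 * c)) * Real.exp (c / 2 * r ^ 2) := by
  rw [← Real.exp_add]
  have h1 : 1 + r ≤ Real.exp r := by linarith [Real.add_one_le_exp r]
  refine h1.trans (Real.exp_le_exp.2 ?_)
  have h2 : 1 / (2 * c) + c / 2 * r ^ 2 - r = (c * r - 1) ^ 2 / (2 * c) := by field_simp; ring
  have h3 : 0 ≤ (c * r - 1) ^ 2 / (2 * c) := by positivity
  linarith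

lemma integrable_exp_neg_mul_norm_sq {p : ℕ} {c : ℝ} (hc : 0 < c) :
    Integrable fun t : Vec p => Real.exp (-c * ‖t‖ ^ 2) := by
  have h := (GaussianFourier.integrable_cexp_neg_mul_sq_norm_add (V := Vec p) (b := (c : ℂ))
    (by simpa using hc) 0 0).norm
  refine h.congr (ae_of_all _ fun t => ?_)
  simp only [Complex.norm_exp]
  congr 1
  simp [← Complex.ofReal_pow, ← Complex.ofReal_neg, ← Complex.ofReal_mul]

lemma integrable_exp_neg_mul_norm_sq_mul_one_add {p : ℕ} {c : ℝ} (hc : 0 < c) :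
    Integrable fun t : Vec p => Real.exp (-c * ‖t‖ ^ 2) * (1 + ‖t‖) := by
  have h := (integrable_exp_neg_mul_norm_sq (p := p) (half_pos hc)).const_mul
    (Real.exp (1 / (2 * c)))
  refine h.mono' (by fun_prop) (ae_of_all _ fun t => ?_)
  rw [Real.norm_of_nonneg (by positivity)]
  calc Real.exp (-c * ‖t‖ ^ 2) * (1 + ‖t‖)
      ≤ Real.exp (-c * ‖t‖ ^ 2) * (Real.exp (1 / (2 * c)) * Real.exp (c / 2 * ‖t‖ ^ 2)) := by
        gcongr; exact one_add_le_exp_sq hc _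
    _ = Real.exp (1 / (2 * c)) * Real.exp (-(c / 2) * ‖t‖ ^ 2) := by
        rw [mul_left_comm, ← Real.exp_add]; congr 2; ring

/-- The Gaussian envelope of a kernel evaluated at a point that is at distance at least
`κ r` from the origin up to a bounded shift. -/
lemma exp_neg_norm_sub_sq_le {d : ℕ} {c κ K r : ℝ} (hc : 0 < c) (hκ : 0 < κ) (hr : 0 ≤ r)
    {x u : Vec d} (hx : ‖x‖ ≤ K) (hu : κ * r ≤ ‖u‖) :
    Real.exp (-c * ‖x - u‖ ^ 2) ≤ Real.exp (c * K ^ 2) * Real.exp (-(c * κ ^ 2 / 2) * r ^ 2) := by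
  rw [← Real.exp_add]
  refine Real.exp_le_exp.2 ?_
  have h1 : ‖u‖ ≤ ‖x - u‖ + ‖x‖ := by
    have := norm_sub_le x (x - u)
    simp only [sub_sub_cancel] at this
    linarith
  have h2 : (κ * r) ^ 2 ≤ 2 * ‖x - u‖ ^ 2 + 2 * K ^ 2 := by
    have h3 : κ * r ≤ ‖x - u‖ + K := by linarith
    have h4 : 0 ≤ κ * r := by positivity
    nlinarith [sq_nonneg (‖x - u‖ - K), norm_nonneg (x - u)]
  nlinarith [mul_le_mul_of_nonneg_left h2 hc.le]

lemma PosDef.exists_eigenvaluesIn {d : ℕ} {M : Matrix (Fin d) (Fin d) ℝ} (hM : M.PosDef) :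
    ∃ c₁ c₂ : ℝ, 0 < c₁ ∧ 0 < c₂ ∧ EigenvaluesIn c₁ c₂ M := by
  have hc : Continuous fun x : Vec d => x.ofLp ⬝ᵥ (M *ᵥ x.ofLp) := by fun_prop
  have hcomp : IsCompact (Metric.sphere (0 : Vec d) 1) := isCompact_sphere _ _
  rcases (Metric.sphere (0 : Vec d) 1).eq_empty_or_nonempty with he | hne
  · refine ⟨1, 1, one_pos, one_pos, fun x => ?_⟩
    have : x = 0 := by
      by_contra hx
      have hx' : WithLp.toLp 2 x ≠ 0 := fun h => hx (by simpa using congrArg WithLp.ofLp h)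
      have : ‖WithLp.toLp 2 x‖⁻¹ • WithLp.toLp 2 x ∈ Metric.sphere (0 : Vec d) 1 := by
        simp [norm_smul, norm_ne_zero_iff.2 hx']
      rw [he] at this
      exact this
    simp [this]
  obtain ⟨x₁, hx₁, hmin⟩ := hcomp.exists_isMinOn hne hc.continuousOn
  obtain ⟨x₂, hx₂, hmax⟩ := hcomp.exists_isMaxOn hne hc.continuousOn
  have hpos : ∀ x ∈ Metric.sphere (0 : Vec d) 1, 0 < x.ofLp ⬝ᵥ (M *ᵥ x.ofLp) := fun x hx => by
    have hx0 : x.ofLp ≠ 0 := fun h => by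
      have : x = 0 := by ext i; simp [h]
      simp [this] at hx
    simpa using hM.dotProduct_mulVec_pos hx0
  refine ⟨_, _, hpos x₁ hx₁, hpos x₂ hx₂, fun x => ?_⟩
  by_cases hx : x = 0
  · simp [hx]
  have hx' : WithLp.toLp 2 x ≠ 0 := fun h => hx (by simpa using congrArg WithLp.ofLp h)
  set r := ‖WithLp.toLp 2 x‖ with hr
  have hr0 : 0 < r := norm_pos_iff.2 hx'
  have hmem : r⁻¹ • WithLp.toLp 2 x ∈ Metric.sphere (0 : Vec d) 1 := by
    simp [norm_smul, ← hr, abs_of_pos hr0, hr0.ne']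
  have hself : x ⬝ᵥ x = r ^ 2 := ofLp_dotProduct_self (WithLp.toLp 2 x)
  have h1 := hmin hmem
  have h2 := hmax hmem
  simp only [Set.mem_ofPred_eq, WithLp.ofLp_smul, mulVec_smul, dotProduct_smul, smul_dotProduct,
    smul_eq_mul] at h1 h2
  rw [hself]
  have h3 : r⁻¹ * (r⁻¹ * (x ⬝ᵥ (M *ᵥ x))) * r ^ 2 = x ⬝ᵥ (M *ᵥ x) := by field_simp
  constructor
  · rw [← h3]; gcongr
  · rw [← h3]; gcongr

section Limit

variable {d p : ℕ} {M : Matrix (Fin d) (Fin d) ℝ} {J : Matrix (Fin d) (Fin p) ℝ}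
  {D : Vec p →L[ℝ] Vec d}

lemma posDef_W_form (hM : M.PosDef) (hJ : Function.Injective J.mulVec) :
    (Jᵀ * M⁻¹ * J).PosDef := by
  have := hM.inv.conjTranspose_mul_mul_same hJ
  rwa [conjTranspose_eq_transpose_of_trivial] at this

/-- Completing the square in the Gaussian exponent. -/
lemma gaussKernel_completeSquare (hM : M.PosDef) (hJ : Function.Injective J.mulVec)
    (hD : ∀ t, (D t).ofLp = J *ᵥ t.ofLp) (x : Vec d) {m : Vec p}
    (hm : m.ofLp = ((Jᵀ * M⁻¹ * J)⁻¹ * (Jᵀ * M⁻¹)) *ᵥ x.ofLp) (s : Vec p) :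
    gaussKernel M (x - D (m + s)) = gaussKernel M (x - D (m + -s)) := by
  have hW : IsUnit (Jᵀ * M⁻¹ * J).det := (posDef_W_form hM hJ).det_pos.ne'.isUnit
  have hJm : Jᵀ *ᵥ (M⁻¹ *ᵥ (x - D m).ofLp) = 0 := by
    rw [WithLp.ofLp_sub, hD, hm, mulVec_mulVec, mulVec_sub, mulVec_mulVec, mulVec_mulVec,
      sub_eq_zero, ← Matrix.mul_assoc, mul_nonsing_inv _ hW, Matrix.one_mul]
  have hsym : M⁻¹ᵀ = M⁻¹ :=
    (conjTranspose_eq_transpose_of_trivial _).symm.trans hM.inv.isHermitian.eq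
  have hcross : ∀ s : Vec p, (D s).ofLp ⬝ᵥ (M⁻¹ *ᵥ (x - D m).ofLp) = 0 := fun s => by
    rw [hD, ← vecMul_transpose, ← dotProduct_mulVec, hJm, dotProduct_zero]
  have hcross' : ∀ s : Vec p, (x - D m).ofLp ⬝ᵥ (M⁻¹ *ᵥ (D s).ofLp) = 0 := fun s => by
    rw [dotProduct_mulVec, ← mulVec_transpose, hsym, dotProduct_comm, hcross]
  have key : ∀ s : Vec p, (x - D (m + s)).ofLp ⬝ᵥ (M⁻¹ *ᵥ (x - D (m + s)).ofLp) =
      (x - D m).ofLp ⬝ᵥ (M⁻¹ *ᵥ (x - D m).ofLp) + (D s).ofLp ⬝ᵥ (M⁻¹ *ᵥ (D s).ofLp) := fun s => by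
    have : (x - D (m + s)).ofLp = (x - D m).ofLp - (D s).ofLp := by
      rw [map_add]; simp [sub_sub]
    rw [this, mulVec_sub, dotProduct_sub, sub_dotProduct, sub_dotProduct, hcross, hcross']
    ring
  unfold gaussKernel
  rw [key, key, map_neg]
  simp [mulVec_neg]

lemma exists_mul_norm_le (hJ : Function.Injective D) :
    ∃ κ : ℝ, 0 < κ ∧ ∀ t, κ * ‖t‖ ≤ ‖D t‖ := by
  obtain ⟨K, hK, hA⟩ := (D : Vec p →ₗ[ℝ] Vec d).exists_antilipschitzWith
    (LinearMap.ker_eq_bot.2 hJ)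
  refine ⟨(K : ℝ)⁻¹, by positivity, fun t => ?_⟩
  have := hA.le_mul_dist t 0
  rw [map_zero, dist_zero_right, dist_zero_right] at this
  rwa [inv_mul_le_iff₀ (by exact_mod_cast hK)]

lemma measurable_gaussKernel_sub (M : Matrix (Fin d) (Fin d) ℝ) (D : Vec p →L[ℝ] Vec d)
    (x : Vec d) : Measurable fun t : Vec p => gaussKernel M (x - D t) :=
  measurable_gaussKernel (fun _ _ => measurable_const) (D.continuous.measurable.const_sub x)

lemma integrable_gaussKernel_mul_one_add (hM : M.PosDef) (hJ : Function.Injective D) (x : Vec d) :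
    Integrable fun t : Vec p => gaussKernel M (x - D t) * (1 + ‖t‖) := by
  obtain ⟨c₁, c₂, hc₁, hc₂, hE⟩ := PosDef.exists_eigenvaluesIn hM
  obtain ⟨κ, hκ, hD⟩ := exists_mul_norm_le hJ
  have hc : 0 < 1 / (2 * c₂) := by positivity
  have hi := (integrable_exp_neg_mul_norm_sq_mul_one_add (p := p)
    (c := 1 / (2 * c₂) * κ ^ 2 / 2) (by positivity)).const_mul
    ((√(c₁ ^ d))⁻¹ * Real.exp (1 / (2 * c₂) * ‖x‖ ^ 2))
  refine hi.mono' ?_ (ae_of_all _ fun t => ?_)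
  · exact ((measurable_gaussKernel_sub M D x).mul
      (measurable_norm.const_add 1)).aestronglyMeasurable
  · rw [Real.norm_of_nonneg (mul_nonneg (gaussKernel_nonneg _ _) (by positivity)), ← mul_assoc]
    gcongr
    refine (hE.gaussKernel_le hM.isHermitian hc₁ hc₂ _).trans ?_
    rw [mul_assoc]
    gcongr
    exact exp_neg_norm_sub_sq_le hc hκ (norm_nonneg t) le_rfl (hD t)

lemma integrable_gaussKernel_smul {E : Type*} [NormedAddCommGroup E] [NormedSpace ℝ E]
    (hM : M.PosDef) (hJ : Function.Injective D) (x : Vec d)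
    {φ : Vec p → E} (hφ : Continuous φ) (hb : ∀ t, ‖φ t‖ ≤ 1 + ‖t‖) :
    Integrable fun t : Vec p => gaussKernel M (x - D t) • φ t := by
  refine (integrable_gaussKernel_mul_one_add hM hJ x).mono' ?_ (ae_of_all _ fun t => ?_)
  · exact (measurable_gaussKernel_sub M D x).aestronglyMeasurable.smul hφ.aestronglyMeasurable
  · rw [norm_smul, Real.norm_of_nonneg (gaussKernel_nonneg _ _)]
    exact mul_le_mul_of_nonneg_left (hb t) (gaussKernel_nonneg _ _)

lemma integrable_gaussKernel (hM : M.PosDef) (hJ : Function.Injective D) (x : Vec d) :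
    Integrable fun t : Vec p => gaussKernel M (x - D t) := by
  simpa using integrable_gaussKernel_smul hM hJ x (φ := fun _ => (1 : ℝ)) continuous_const
    (fun t => by simp)

lemma integral_gaussKernel_pos (hM : M.PosDef) (hJ : Function.Injective D) (x : Vec d) :
    0 < ∫ t : Vec p, gaussKernel M (x - D t) := by
  rw [integral_pos_iff_support_of_nonneg (fun t => gaussKernel_nonneg _ _)
    (integrable_gaussKernel hM hJ x)]
  have : Function.support (fun t : Vec p => gaussKernel M (x - D t)) = Set.univ := by
    ext t; simpa using (gaussKernel_pos hM.det_pos _).ne'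
  rw [this]
  exact Measure.measure_univ_pos.2 (NeZero.ne _)

/-- The mean of the limiting Gaussian posterior is the generalized least squares estimate. -/
lemma integral_gaussKernel_smul_id (hM : M.PosDef) (hJ : Function.Injective J.mulVec)
    (hD : ∀ t, (D t).ofLp = J *ᵥ t.ofLp) (hDi : Function.Injective D) (x : Vec d) {m : Vec p}
    (hm : m.ofLp = ((Jᵀ * M⁻¹ * J)⁻¹ * (Jᵀ * M⁻¹)) *ᵥ x.ofLp) :
    ∫ t : Vec p, gaussKernel M (x - D t) • t = (∫ t : Vec p, gaussKernel M (x - D t)) • m := by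
  have hi := integrable_gaussKernel hM hDi x
  have hi' := integrable_gaussKernel_smul hM hDi x (φ := fun t => t) continuous_id (by simp)
  have h0 : ∫ t : Vec p, gaussKernel M (x - D t) • (t - m) = 0 := by
    rw [← integral_add_left_eq_self _ m]
    simp only [add_sub_cancel_left]
    have h1 : ∫ s : Vec p, gaussKernel M (x - D (m + s)) • s =
        - ∫ s : Vec p, gaussKernel M (x - D (m + s)) • s := by
      conv_lhs => rw [← integral_neg_eq_self]
      rw [← integral_neg]
      refine integral_congr_ae (ae_of_all _ fun s => ?_)
      simp only [gaussKernel_completeSquare hM hJ hD x hm s, smul_neg]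
    have h2 : (2 : ℝ) • ∫ s : Vec p, gaussKernel M (x - D (m + s)) • s = 0 := by
      rw [two_smul]; exact add_eq_zero_iff_eq_neg.2 h1
    simpa using h2
  simp only [smul_sub] at h0
  rw [integral_sub hi' (hi.smul_const m), integral_smul_const, sub_eq_zero] at h0
  exact h0

end Limit

end SynthLik

namespace SynthLik

lemma integral_comp_add_inv_smul {p : ℕ} {E : Type*} [NormedAddCommGroup E] [NormedSpace ℝ E]
    (h : Vec p → E) (θ₀ : Vec p) {v : ℝ} (hv : 0 < v) :
    ∫ t, h (θ₀ + v⁻¹ • t) = v ^ p • ∫ θ, h θ := by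
  rw [Measure.integral_comp_inv_smul_of_nonneg volume (fun t => h (θ₀ + t)) hv.le,
    integral_add_left_eq_self, finrank_euclideanSpace, Fintype.card_fin]

lemma tendsto_pow_mul_exp_neg_sq {c : ℝ} (hc : 0 < c) (p : ℕ) :
    Tendsto (fun v : ℝ => v ^ p * (1 + v) * Real.exp (-c * v ^ 2)) atTop (𝓝 0) := by
  have h1 : ∀ n : ℕ, Tendsto (fun v : ℝ => v ^ n * Real.exp (-c * v)) atTop (𝓝 0) := fun n => by
    simpa using tendsto_rpow_mul_exp_neg_mul_atTop_nhds_zero (n : ℝ) c hc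
  have h2 := (h1 p).add (h1 (p + 1))
  rw [add_zero] at h2
  refine squeeze_zero' ?_ ?_ h2
  · filter_upwards [eventually_ge_atTop 0] with v hv; positivity
  · filter_upwards [eventually_ge_atTop 1] with v hv
    have : Real.exp (-c * v ^ 2) ≤ Real.exp (-c * v) := Real.exp_le_exp.2 (by
      nlinarith [mul_le_mul_of_nonneg_left hv (mul_nonneg hc.le (zero_le_one.trans hv))])
    calc v ^ p * (1 + v) * Real.exp (-c * v ^ 2) ≤ v ^ p * (1 + v) * Real.exp (-c * v) := by gcongr
      _ = _ := by ring

lemma integrableOn_mul_prior_smul {p : ℕ} {E : Type*} [NormedAddCommGroup E] [NormedSpace ℝ E]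
    {Θ : Set (Vec p)} (hΘ : MeasurableSet Θ) {prior : Vec p → ℝ}
    (hp0 : ∀ θ ∈ Θ, 0 ≤ prior θ) (hpi : IntegrableOn prior Θ)
    (hmom : IntegrableOn (fun θ => ‖θ‖ * prior θ) Θ) {g : Vec p → ℝ} (hg : Measurable g) {C : ℝ}
    (hgC : ∀ θ ∈ Θ, |g θ| ≤ C) {ψ : Vec p → E} (hψ : Continuous ψ) {C' : ℝ}
    (hψC : ∀ θ, ‖ψ θ‖ ≤ C' * (1 + ‖θ‖)) :
    IntegrableOn (fun θ => (g θ * prior θ) • ψ θ) Θ := by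
  have hi := (hpi.add hmom).const_mul (C * C')
  refine Integrable.mono' hi ?_ ?_
  · exact (hg.aestronglyMeasurable.mul hpi.aestronglyMeasurable).smul hψ.aestronglyMeasurable
  · filter_upwards [ae_restrict_mem hΘ] with θ hθ
    rw [norm_smul, norm_mul, Real.norm_of_nonneg (hp0 θ hθ), Real.norm_eq_abs]
    have hC : 0 ≤ C := (abs_nonneg _).trans (hgC θ hθ)
    calc |g θ| * prior θ * ‖ψ θ‖ ≤ C * prior θ * (C' * (1 + ‖θ‖)) :=
          mul_le_mul (mul_le_mul_of_nonneg_right (hgC θ hθ) (hp0 θ hθ)) (hψC θ) (norm_nonneg _)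
            (mul_nonneg hC (hp0 θ hθ))
      _ = C * C' * (prior θ + ‖θ‖ * prior θ) := by ring

section Rescaled

variable {d p : ℕ} {E : Type*} [NormedAddCommGroup E] [NormedSpace ℝ E]
  {Θ : Set (Vec p)} {prior : Vec p → ℝ} {b : Vec p → Vec d} {θ₀ : Vec p} {D : Vec p →L[ℝ] Vec d}
  {v : ℕ → ℝ} {M : ℕ → Vec p → Matrix (Fin d) (Fin d) ℝ} {M₀ : Matrix (Fin d) (Fin d) ℝ}
  {x : ℕ → Vec d} {x₀ : Vec d} {c₁ c₂ : ℝ} {φ : Vec p → E}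

/-- Laplace approximation near `θ₀`: dominated convergence after rescaling. -/
lemma tendsto_setIntegral_closedBall {δ κ C K : ℝ} (hδ : 0 < δ) (hκ : 0 < κ)
    (hpm : Measurable prior) (hpc : ContinuousAt prior θ₀)
    (hpC : ∀ θ ∈ Metric.closedBall θ₀ δ, |prior θ| ≤ C)
    (hbm : Measurable b) (hb : HasFDerivAt b D θ₀)
    (hbκ : ∀ θ ∈ Metric.closedBall θ₀ δ, κ * ‖θ - θ₀‖ ≤ ‖b θ - b θ₀‖)
    (hv : ∀ k, 0 < v k) (hvt : Tendsto v atTop atTop)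
    (hMm : ∀ k i j, Measurable fun θ => M k θ i j) (hc₁ : 0 < c₁) (hc₂ : 0 < c₂)
    (hMh : ∀ k, ∀ θ, (M k θ).IsHermitian)
    (hE : ∀ k, ∀ θ ∈ Metric.closedBall θ₀ δ, EigenvaluesIn c₁ c₂ (M k θ))
    (hM₀ : 0 < M₀.det)
    (hM : Tendsto (fun q : ℕ × Vec p => M q.1 q.2) (atTop ×ˢ 𝓝 θ₀) (𝓝 M₀))
    (hx : Tendsto x atTop (𝓝 x₀)) (hxK : ∀ k, ‖x k‖ ≤ K)
    (hφ : Continuous φ) (hφ1 : ∀ t, ‖φ t‖ ≤ 1 + ‖t‖) :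
    Tendsto (fun k => ∫ θ in Metric.closedBall θ₀ δ,
      (v k ^ p * (gaussKernel (M k θ) (x k - v k • (b θ - b θ₀)) * prior θ)) •
        φ (v k • (θ - θ₀))) atTop
      (𝓝 (∫ t, (gaussKernel M₀ (x₀ - D t) * prior θ₀) • φ t)) := by
  set S := Metric.closedBall θ₀ δ with hS
  set G : ℕ → Vec p → E := fun k θ =>
    (gaussKernel (M k θ) (x k - v k • (b θ - b θ₀)) * prior θ) • φ (v k • (θ - θ₀)) with hG
  have hch : ∀ k, ∫ θ in S, (v k ^ p * (gaussKernel (M k θ) (x k - v k • (b θ - b θ₀)) * prior θ)) •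
        φ (v k • (θ - θ₀)) = ∫ t, S.indicator (G k) (θ₀ + (v k)⁻¹ • t) := fun k => by
    rw [integral_comp_add_inv_smul _ _ (hv k), integral_indicator Metric.isClosed_closedBall.measurableSet,
      ← integral_smul]
    refine integral_congr_ae (ae_of_all _ fun θ => ?_)
    simp only [hG, smul_smul]
  simp only [hch]
  have hscale : ∀ k (t : Vec p), v k • (θ₀ + (v k)⁻¹ • t - θ₀) = t := fun k t => by
    rw [add_sub_cancel_left, smul_inv_smul₀ (hv k).ne']
  set c := 1 / (2 * c₂) with hc
  have hc0 : 0 < c := by positivity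
  have hGm : ∀ k, StronglyMeasurable (G k) := fun k =>
    ((measurable_gaussKernel (hMm k)
      (((hbm.sub_const _).const_smul (v k)).const_sub (x k))).mul hpm).stronglyMeasurable.smul
      (hφ.comp (by fun_prop)).stronglyMeasurable
  refine tendsto_integral_of_dominated_convergence
    (fun t => (√(c₁ ^ d))⁻¹ * Real.exp (c * K ^ 2) * C *
      (Real.exp (-(c * κ ^ 2 / 2) * ‖t‖ ^ 2) * (1 + ‖t‖))) ?_ ?_ ?_ ?_
  · intro k
    exact (((hGm k).indicator Metric.isClosed_closedBall.measurableSet).comp_measurable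
      (by fun_prop)).aestronglyMeasurable
  · exact (integrable_exp_neg_mul_norm_sq_mul_one_add (by positivity)).const_mul _
  · intro k
    refine ae_of_all _ fun t => ?_
    by_cases ht : θ₀ + (v k)⁻¹ • t ∈ S
    · rw [Set.indicator_of_mem ht]
      simp only [hG, hscale]
      set θ := θ₀ + (v k)⁻¹ • t with hθ
      have hu : κ * ‖t‖ ≤ ‖v k • (b θ - b θ₀)‖ := by
        have h1 : v k * ‖θ - θ₀‖ = ‖t‖ := by
          rw [← hscale k t, norm_smul, Real.norm_of_nonneg (hv k).le]
        rw [norm_smul, Real.norm_of_nonneg (hv k).le, ← h1, mul_left_comm]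
        exact mul_le_mul_of_nonneg_left (hbκ θ ht) (hv k).le
      have h2 := (hE k θ ht).gaussKernel_le (hMh k θ) hc₁ hc₂ (x k - v k • (b θ - b θ₀))
      have h3 := exp_neg_norm_sub_sq_le hc0 hκ (norm_nonneg t) (hxK k) hu
      rw [norm_smul, norm_mul, Real.norm_of_nonneg (gaussKernel_nonneg _ _), Real.norm_eq_abs]
      have h4 : gaussKernel (M k θ) (x k - v k • (b θ - b θ₀)) ≤
          (√(c₁ ^ d))⁻¹ * (Real.exp (c * K ^ 2) * Real.exp (-(c * κ ^ 2 / 2) * ‖t‖ ^ 2)) :=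
        h2.trans (mul_le_mul_of_nonneg_left h3 (by positivity))
      calc _ ≤ (√(c₁ ^ d))⁻¹ * (Real.exp (c * K ^ 2) * Real.exp (-(c * κ ^ 2 / 2) * ‖t‖ ^ 2))
            * C * (1 + ‖t‖) :=
            mul_le_mul (mul_le_mul h4 (hpC θ ht) (abs_nonneg _) (by positivity)) (hφ1 t)
              (norm_nonneg _) (mul_nonneg (by positivity) ((abs_nonneg _).trans (hpC θ ht)))
        _ = _ := by ring
    · rw [Set.indicator_of_notMem ht, norm_zero]
      have hC : 0 ≤ C := (abs_nonneg _).trans (hpC θ₀ (Metric.mem_closedBall_self hδ.le))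
      positivity
  · refine ae_of_all _ fun t => ?_
    have hθ : Tendsto (fun k => θ₀ + (v k)⁻¹ • t) atTop (𝓝 θ₀) := by
      simpa using (hvt.inv_tendsto_atTop.smul_const t).const_add θ₀
    have hmem : ∀ᶠ k in atTop, θ₀ + (v k)⁻¹ • t ∈ S :=
      hθ.eventually (Metric.closedBall_mem_nhds θ₀ hδ)
    have hlim : Tendsto (fun k => v k • (b (θ₀ + (v k)⁻¹ • t) - b θ₀)) atTop (𝓝 (D t)) :=
      hb.lim t (tendsto_norm_atTop_atTop.comp hvt)
    have hMk : Tendsto (fun k => M k (θ₀ + (v k)⁻¹ • t)) atTop (𝓝 M₀) :=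
      hM.comp (tendsto_id.prodMk hθ)
    have hmain := ((tendsto_gaussKernel hMk (hx.sub hlim) hM₀).mul
      (hpc.tendsto.comp hθ)).smul_const (φ t)
    refine hmain.congr' ?_
    filter_upwards [hmem] with k hk
    rw [Set.indicator_of_mem hk]
    simp only [hG, hscale, Function.comp_apply]

/-- Away from `θ₀` the likelihood is exponentially small. -/
lemma tendsto_setIntegral_far {δ ε K : ℝ} (hε : 0 < ε)
    (hΘ : MeasurableSet Θ) (hp0 : ∀ θ ∈ Θ, 0 ≤ prior θ) (hpi : IntegrableOn prior Θ)
    (hmom : IntegrableOn (fun θ => ‖θ‖ * prior θ) Θ)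
    (hbε : ∀ θ ∈ Θ, θ ∉ Metric.closedBall θ₀ δ → ε ≤ ‖b θ - b θ₀‖)
    (hv : ∀ k, 0 < v k) (hvt : Tendsto v atTop atTop) (hc₁ : 0 < c₁) (hc₂ : 0 < c₂)
    (hMh : ∀ k, ∀ θ, (M k θ).IsHermitian)
    (hE : ∀ k, ∀ θ ∈ Θ, EigenvaluesIn c₁ c₂ (M k θ))
    (hxK : ∀ k, ‖x k‖ ≤ K) (hφ1 : ∀ t, ‖φ t‖ ≤ 1 + ‖t‖) :
    Tendsto (fun k => ∫ θ in Θ \ Metric.closedBall θ₀ δ,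
      (v k ^ p * (gaussKernel (M k θ) (x k - v k • (b θ - b θ₀)) * prior θ)) •
        φ (v k • (θ - θ₀))) atTop (𝓝 0) := by
  set S := Θ \ Metric.closedBall θ₀ δ with hS
  have hSm : MeasurableSet S := hΘ.diff Metric.isClosed_closedBall.measurableSet
  set c := 1 / (2 * c₂) with hc
  have hc0 : 0 < c := by positivity
  set A := (√(c₁ ^ d))⁻¹ * Real.exp (c * K ^ 2) with hA
  have hint : IntegrableOn (fun θ => (1 + ‖θ₀‖) * prior θ + ‖θ‖ * prior θ) S :=
    IntegrableOn.mono_set (Integrable.add (hpi.const_mul _) hmom) Set.sdiff_subset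
  set I := ∫ θ in S, ((1 + ‖θ₀‖) * prior θ + ‖θ‖ * prior θ) with hI
  have hb : ∀ k, ‖∫ θ in S, (v k ^ p * (gaussKernel (M k θ) (x k - v k • (b θ - b θ₀)) * prior θ)) •
        φ (v k • (θ - θ₀))‖ ≤
      (v k ^ p * (1 + v k) * Real.exp (-(c * ε ^ 2 / 2) * v k ^ 2)) * (A * I) := fun k => by
    have hvk := hv k
    calc _ ≤ ∫ θ in S, (v k ^ p * (1 + v k) * Real.exp (-(c * ε ^ 2 / 2) * v k ^ 2)) * A *
          ((1 + ‖θ₀‖) * prior θ + ‖θ‖ * prior θ) := by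
          refine norm_integral_le_of_norm_le (hint.const_mul _) ?_
          filter_upwards [ae_restrict_mem hSm] with θ hθ
          have hu : ε * v k ≤ ‖v k • (b θ - b θ₀)‖ := by
            rw [norm_smul, Real.norm_of_nonneg hvk.le, mul_comm]
            exact mul_le_mul_of_nonneg_left (hbε θ hθ.1 hθ.2) hvk.le
          have h2 := (hE k θ hθ.1).gaussKernel_le (hMh k θ) hc₁ hc₂ (x k - v k • (b θ - b θ₀))
          have h3 := exp_neg_norm_sub_sq_le hc0 hε hvk.le (hxK k) hu
          have h4 : gaussKernel (M k θ) (x k - v k • (b θ - b θ₀)) ≤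
              A * Real.exp (-(c * ε ^ 2 / 2) * v k ^ 2) := by
            rw [hA, mul_assoc]
            exact h2.trans (mul_le_mul_of_nonneg_left h3 (by positivity))
          have h5 : ‖φ (v k • (θ - θ₀))‖ ≤ (1 + v k) * (1 + ‖θ₀‖ + ‖θ‖) := by
            refine (hφ1 _).trans ?_
            rw [norm_smul, Real.norm_of_nonneg hvk.le]
            have := norm_sub_le θ θ₀
            have h6 := mul_le_mul_of_nonneg_left this hvk.le
            nlinarith [norm_nonneg θ, norm_nonneg θ₀]
          have hp := hp0 θ hθ.1
          rw [norm_smul, norm_mul, norm_mul, Real.norm_of_nonneg (gaussKernel_nonneg _ _),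
            Real.norm_of_nonneg hp, Real.norm_of_nonneg (by positivity : 0 ≤ v k ^ p)]
          calc _ ≤ v k ^ p * ((A * Real.exp (-(c * ε ^ 2 / 2) * v k ^ 2)) * prior θ) *
                ((1 + v k) * (1 + ‖θ₀‖ + ‖θ‖)) := by
                gcongr
            _ = _ := by ring
      _ = _ := by rw [integral_const_mul]; ring
  have hlim : Tendsto (fun k => (v k ^ p * (1 + v k) * Real.exp (-(c * ε ^ 2 / 2) * v k ^ 2)) *
      (A * I)) atTop (𝓝 0) := by
    simpa using ((tendsto_pow_mul_exp_neg_sq (c := c * ε ^ 2 / 2) (by positivity) p).comp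
      hvt).mul_const (A * I)
  exact squeeze_zero_norm hb hlim

/-- The Laplace approximation of posterior integrals on the scale `1 / v`. -/
theorem tendsto_rescaled_integral
    (hΘ : MeasurableSet Θ) (hpm : Measurable prior) (hp0 : ∀ θ ∈ Θ, 0 ≤ prior θ)
    (hpi : IntegrableOn prior Θ) (hmom : IntegrableOn (fun θ => ‖θ‖ * prior θ) Θ)
    (hpc : ContinuousAt prior θ₀) (hθ₀ : θ₀ ∈ interior Θ)
    (hbm : Measurable b) (hb : HasFDerivAt b D θ₀) (hD : Function.Injective D)
    (hid : ∀ δ : ℝ, 0 < δ → ∃ ε : ℝ, 0 < ε ∧ ∀ θ ∈ Θ, ‖b θ - b θ₀‖ < ε → ‖θ - θ₀‖ < δ)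
    (hv : ∀ k, 0 < v k) (hvt : Tendsto v atTop atTop)
    (hMm : ∀ k i j, Measurable fun θ => M k θ i j) (hc₁ : 0 < c₁) (hc₂ : 0 < c₂)
    (hMh : ∀ k, ∀ θ, (M k θ).IsHermitian)
    (hE : ∀ k, ∀ θ ∈ Θ, EigenvaluesIn c₁ c₂ (M k θ))
    (hM₀ : 0 < M₀.det)
    (hM : Tendsto (fun q : ℕ × Vec p => M q.1 q.2) (atTop ×ˢ 𝓝 θ₀) (𝓝 M₀))
    (hx : Tendsto x atTop (𝓝 x₀))
    (hφ : Continuous φ) (hφ1 : ∀ t, ‖φ t‖ ≤ 1 + ‖t‖) :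
    Tendsto (fun k => ∫ θ in Θ,
      (v k ^ p * (gaussKernel (M k θ) (x k - v k • (b θ - b θ₀)) * prior θ)) •
        φ (v k • (θ - θ₀))) atTop
      (𝓝 (∫ t, (gaussKernel M₀ (x₀ - D t) * prior θ₀) • φ t)) := by
  obtain ⟨K, hK⟩ : ∃ K, ∀ k, ‖x k‖ ≤ K := by
    obtain ⟨K, hK⟩ := (Metric.isBounded_range_of_tendsto x hx).exists_norm_le
    exact ⟨K, fun k => hK _ ⟨k, rfl⟩⟩
  obtain ⟨κ, hκ, hDκ⟩ := exists_mul_norm_le hD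
  have hnear : ∀ᶠ θ in 𝓝 θ₀, θ ∈ Θ ∧ |prior θ| ≤ |prior θ₀| + 1 ∧
      κ / 2 * ‖θ - θ₀‖ ≤ ‖b θ - b θ₀‖ := by
    have h1 : ∀ᶠ θ in 𝓝 θ₀, |prior θ| < |prior θ₀| + 1 :=
      hpc.abs.eventually_lt_const (by linarith)
    have h2 := hb.isLittleO.def (half_pos hκ)
    filter_upwards [mem_interior_iff_mem_nhds.1 hθ₀, h1, h2] with θ h3 h4 h5
    refine ⟨h3, h4.le, ?_⟩
    have h6 := hDκ (θ - θ₀)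
    have h7 := norm_sub_norm_le (D (θ - θ₀)) (b θ - b θ₀)
    rw [norm_sub_rev (D _) (b θ - b θ₀)] at h7
    linarith
  obtain ⟨δ, hδ, hball⟩ := Metric.nhds_basis_closedBall.eventually_iff.1 hnear
  obtain ⟨ε, hε, hfar⟩ := hid δ hδ
  have h1 := tendsto_setIntegral_closedBall (φ := φ) hδ (half_pos hκ) hpm hpc
    (fun θ hθ => (hball hθ).2.1) hbm hb (fun θ hθ => (hball hθ).2.2) hv hvt hMm hc₁ hc₂ hMh
    (fun k θ hθ => hE k θ (hball hθ).1) hM₀ hM hx hK hφ hφ1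
  have h2 := tendsto_setIntegral_far (φ := φ) (x := x) hε hΘ hp0 hpi hmom
    (fun θ hθ hn => not_lt.1 fun hlt => hn (by
      rw [Metric.mem_closedBall, dist_eq_norm]; exact (hfar θ hθ hlt).le)) hv hvt hc₁ hc₂ hMh hE hK hφ1
  have h3 := h1.add h2
  rw [add_zero] at h3
  refine h3.congr fun k => ?_
  have hint : IntegrableOn (fun θ =>
      (v k ^ p * (gaussKernel (M k θ) (x k - v k • (b θ - b θ₀)) * prior θ)) •
        φ (v k • (θ - θ₀))) Θ := by
    simp only [← mul_assoc]
    refine integrableOn_mul_prior_smul hΘ hp0 hpi hmom (C := v k ^ p * (√(c₁ ^ d))⁻¹)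
      (C' := (1 + v k) * (1 + ‖θ₀‖)) ?_ ?_ (hφ.comp (by fun_prop)) ?_
    · exact (measurable_gaussKernel (hMm k)
        (((hbm.sub_const _).const_smul (v k)).const_sub (x k))).const_mul _
    · intro θ hθ
      have hvk := hv k
      rw [abs_of_nonneg (mul_nonneg (by positivity) (gaussKernel_nonneg _ _))]
      refine mul_le_mul_of_nonneg_left (((hE k θ hθ).gaussKernel_le (hMh k θ) hc₁ hc₂ _).trans ?_)
        (by positivity)
      refine mul_le_of_le_one_right (by positivity) (Real.exp_le_one_iff.2 ?_)
      have : 0 ≤ 1 / (2 * c₂) * ‖x k - v k • (b θ - b θ₀)‖ ^ 2 := by positivity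
      linarith
    · intro θ
      refine (hφ1 _).trans ?_
      rw [norm_smul, Real.norm_of_nonneg (hv k).le]
      have h6 := mul_le_mul_of_nonneg_left (norm_sub_le θ θ₀) (hv k).le
      have h7 : 0 ≤ v k := (hv k).le
      have h8 : 0 ≤ ‖θ₀‖ * ‖θ‖ := by positivity
      nlinarith [norm_nonneg θ, norm_nonneg θ₀, mul_nonneg h7 h8]
  have hsplit := integral_inter_add_sdiff (μ := volume) (s := Θ)
    (t := Metric.closedBall θ₀ δ) Metric.isClosed_closedBall.measurableSet hint
  rw [Set.inter_eq_right.2 fun θ hθ => (hball hθ).1] at hsplit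
  exact hsplit

end Rescaled

end SynthLik

namespace SynthLik

section Posterior

variable {d p : ℕ} {Θ : Set (Vec p)} {prior : Vec p → ℝ} {b : Vec p → Vec d} {θ₀ : Vec p}
  {A : Vec p → Matrix (Fin d) (Fin d) ℝ} {c₁ c₂ : ℝ}

lemma IsPriorDensity.integrableOn (h : IsPriorDensity Θ prior) : IntegrableOn prior Θ := by
  by_contra hn
  have := h.integral_eq_one
  rw [integral_undef hn] at this
  exact zero_ne_one this

lemma isHermitian_smul_transpose_mul_self (A : Matrix (Fin d) (Fin d) ℝ) (r : ℝ) :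
    (r • (Aᵀ * A)).IsHermitian := by
  rw [IsHermitian, conjTranspose_eq_transpose_of_trivial, transpose_smul, transpose_mul,
    transpose_transpose]

lemma measurable_smul_transpose_mul_self {α : Type*} [MeasurableSpace α]
    {A : α → Matrix (Fin d) (Fin d) ℝ} (hA : ∀ i j, Measurable fun a => A a i j) (r : ℝ)
    (i j : Fin d) : Measurable fun a => (r • ((A a)ᵀ * A a)) i j := by
  simp only [Matrix.smul_apply, Matrix.mul_apply, transpose_apply]
  exact (Finset.measurable_sum _ fun k _ => (hA k i).mul (hA k j)).const_smul r

lemma EigenvaluesIn.gaussKernel_le_const {M : Matrix (Fin d) (Fin d) ℝ}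
    (h : EigenvaluesIn c₁ c₂ M) (hM : M.IsHermitian) (hc : 0 < c₁) (hc₂ : 0 < c₂) (z : Vec d) :
    gaussKernel M z ≤ (√(c₁ ^ d))⁻¹ := by
  refine (h.gaussKernel_le hM hc hc₂ z).trans ?_
  refine mul_le_of_le_one_right (by positivity) (Real.exp_le_one_iff.2 ?_)
  have : 0 ≤ 1 / (2 * c₂) * ‖z‖ ^ 2 := by positivity
  linarith

lemma measurable_synLik {α : Type*} [MeasurableSpace α] {A : α → Vec p → Matrix (Fin d) (Fin d) ℝ}
    {s : α → Vec d} (hA : ∀ i j, Measurable fun q : α × Vec p => A q.1 q.2 i j)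
    (hs : Measurable s) (hbm : Measurable b) :
    Measurable fun q : α × Vec p => synLik b (A q.1) (s q.1) q.2 := by
  simp only [synLik_eq_gaussKernel b _ _ _ one_pos, one_smul]
  refine (measurable_gaussKernel (fun i j => ?_)
    ((hs.comp measurable_fst).sub (hbm.comp measurable_snd))).const_mul _
  simpa using measurable_smul_transpose_mul_self hA 1 i j

lemma measurable_synLik_right (hA : ∀ i j, Measurable fun θ => A θ i j) (hbm : Measurable b)
    (s : Vec d) : Measurable fun θ => synLik b A s θ := by
  simp only [synLik_eq_gaussKernel b _ _ _ one_pos, one_smul]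
  refine (measurable_gaussKernel (fun i j => ?_) (hbm.const_sub s)).const_mul _
  simpa using measurable_smul_transpose_mul_self hA 1 i j

lemma measurable_posteriorMean {α : Type*} [MeasurableSpace α]
    {A : α → Vec p → Matrix (Fin d) (Fin d) ℝ} {s : α → Vec d}
    (hA : ∀ i j, Measurable fun q : α × Vec p => A q.1 q.2 i j)
    (hs : Measurable s) (hbm : Measurable b) (hpm : Measurable prior) :
    Measurable fun a => posteriorMean Θ prior b (A a) (s a) := by
  have h1 : Measurable fun q : α × Vec p => synLik b (A q.1) (s q.1) q.2 * prior q.2 :=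
    (measurable_synLik hA hs hbm).mul (hpm.comp measurable_snd)
  have h2 : StronglyMeasurable fun a => evidence Θ prior b (A a) (s a) :=
    h1.stronglyMeasurable.integral_prod_right (ν := volume.restrict Θ)
  have h3 : Measurable fun q : α × Vec p =>
      posteriorDensity Θ prior b (A q.1) (s q.1) q.2 • q.2 :=
    (h1.div (h2.measurable.comp measurable_fst)).smul measurable_snd
  exact (h3.stronglyMeasurable.integral_prod_right (ν := volume.restrict Θ)).measurable

lemma posteriorMeanExists_of_eigenvaluesIn (hprior : IsPriorDensity Θ prior)
    (hmom : IntegrableOn (fun θ => ‖θ‖ * prior θ) Θ) (hbm : Measurable b)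
    (hA : ∀ i j, Measurable fun θ => A θ i j) {v : ℝ} (hv : 0 < v) (hc₁ : 0 < c₁) (hc₂ : 0 < c₂)
    (hE : ∀ θ ∈ Θ, EigenvaluesIn c₁ c₂ (v ^ 2 • ((A θ)ᵀ * A θ))) (s : Vec d) :
    PosteriorMeanExists Θ prior b A s := by
  have hm : Measurable fun θ => synLik b A s θ := measurable_synLik_right hA hbm s
  have hpos : ∀ θ ∈ Θ, 0 < synLik b A s θ := fun θ hθ => by
    rw [synLik_eq_gaussKernel b A s θ hv]
    have := gaussKernel_pos ((hE θ hθ).posDef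
      (isHermitian_smul_transpose_mul_self _ _) hc₁).det_pos (v • (s - b θ))
    positivity
  have hle : ∀ θ ∈ Θ, |synLik b A s θ| ≤ (√((2 * Real.pi) ^ d))⁻¹ * v ^ d * (√(c₁ ^ d))⁻¹ :=
    fun θ hθ => by
      rw [abs_of_pos (hpos θ hθ), synLik_eq_gaussKernel b A s θ hv]
      exact mul_le_mul_of_nonneg_left ((hE θ hθ).gaussKernel_le_const
        (isHermitian_smul_transpose_mul_self _ _) hc₁ hc₂ _) (by positivity)
  have hi : IntegrableOn (fun θ => synLik b A s θ * prior θ) Θ := by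
    simpa using integrableOn_mul_prior_smul hprior.measurableSet hprior.nonneg hprior.integrableOn
      hmom hm hle (ψ := fun _ => (1 : ℝ)) continuous_const (C' := 1) (fun θ => by simp)
  have hi' : IntegrableOn (fun θ => (synLik b A s θ * prior θ) • θ) Θ :=
    integrableOn_mul_prior_smul hprior.measurableSet hprior.nonneg hprior.integrableOn
      hmom hm hle (ψ := fun θ => θ) continuous_id (C' := 1) (fun θ => by simp)
  refine ⟨hi, ?_, ?_⟩
  · have hp : 0 < ∫ θ in Θ, prior θ := by rw [hprior.integral_eq_one]; exact one_pos
    rw [setIntegral_pos_iff_support_of_nonneg_ae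
      ((ae_restrict_iff' hprior.measurableSet).2 (ae_of_all _ hprior.nonneg))
      hprior.integrableOn] at hp
    rw [evidence, setIntegral_pos_iff_support_of_nonneg_ae
      ((ae_restrict_iff' hprior.measurableSet).2 (ae_of_all _ fun θ hθ =>
        mul_nonneg (hpos θ hθ).le (hprior.nonneg θ hθ))) hi]
    refine hp.trans_le (measure_mono fun θ hθ => ⟨?_, hθ.2⟩)
    exact mul_ne_zero (hpos θ hθ.2).ne' hθ.1
  · refine (Integrable.smul (evidence Θ prior b A s)⁻¹ hi').congr (ae_of_all _ fun θ => ?_)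
    simp only [Pi.smul_apply, posteriorDensity, smul_smul, div_eq_inv_mul]

lemma smul_posteriorMean_sub {s : Vec d} (h : PosteriorMeanExists Θ prior b A s) {v : ℝ}
    (hv : 0 < v) :
    v • (posteriorMean Θ prior b A s - θ₀) =
      (∫ θ in Θ, (v ^ p * (gaussKernel (v ^ 2 • ((A θ)ᵀ * A θ))
        (v • (s - b θ₀) - v • (b θ - b θ₀)) * prior θ)) • (1 : ℝ))⁻¹ •
      ∫ θ in Θ, (v ^ p * (gaussKernel (v ^ 2 • ((A θ)ᵀ * A θ))
        (v • (s - b θ₀) - v • (b θ - b θ₀)) * prior θ)) • (v • (θ - θ₀)) := by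
  set g : Vec p → ℝ := fun θ => gaussKernel (v ^ 2 • ((A θ)ᵀ * A θ))
        (v • (s - b θ₀) - v • (b θ - b θ₀)) * prior θ with hg
  set C := (√((2 * Real.pi) ^ d))⁻¹ * v ^ d with hC
  have hC0 : C ≠ 0 := by positivity
  have hsyn : ∀ θ, synLik b A s θ * prior θ = C * g θ := fun θ => by
    have e : v • (s - b θ₀) - v • (b θ - b θ₀) = v • (s - b θ) := by
      rw [← smul_sub, sub_sub_sub_cancel_right]
    simp only [hg, e]
    rw [synLik_eq_gaussKernel b A s θ hv, mul_assoc]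
  obtain ⟨h1, h2, h3⟩ := h
  set Z := ∫ θ in Θ, g θ with hZ
  have hev : evidence Θ prior b A s = C * Z := by
    simp only [evidence, hsyn, integral_const_mul, hZ]
  have hZ0 : Z ≠ 0 := fun h0 => by simp [hev, h0] at h2
  have hpd : ∀ θ, posteriorDensity Θ prior b A s θ = Z⁻¹ * g θ := fun θ => by
    rw [posteriorDensity, hsyn, hev, mul_div_mul_left _ _ hC0, div_eq_inv_mul]
  have hgi : IntegrableOn g Θ := by
    refine (h1.const_mul C⁻¹).congr (ae_of_all _ fun θ => ?_)
    simp only [hsyn, inv_mul_cancel_left₀ hC0]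
  have hgi' : IntegrableOn (fun θ => g θ • θ) Θ := by
    refine (Integrable.smul Z h3).congr (ae_of_all _ fun θ => ?_)
    simp only [Pi.smul_apply, hpd, smul_smul, mul_inv_cancel_left₀ hZ0]
  have hpm : posteriorMean Θ prior b A s = Z⁻¹ • ∫ θ in Θ, g θ • θ := by
    simp only [posteriorMean, hpd, mul_smul, integral_smul]
  have hN : ∫ θ in Θ, (v ^ p * g θ) • (v • (θ - θ₀)) =
      (v ^ p * v) • ((∫ θ in Θ, g θ • θ) - Z • θ₀) := by
    rw [hZ, ← integral_smul_const, ← integral_sub hgi' (hgi.smul_const θ₀), ← integral_smul]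
    refine integral_congr_ae (ae_of_all _ fun θ => ?_)
    simp only [← smul_sub, smul_smul]
    congr 1; ring
  have hD : ∫ θ in Θ, (v ^ p * g θ) • (1 : ℝ) = v ^ p * Z := by
    simp only [smul_eq_mul, mul_one, integral_const_mul, hZ]
  change _ = (∫ θ in Θ, (v ^ p * g θ) • (1 : ℝ))⁻¹ • ∫ θ in Θ, (v ^ p * g θ) • (v • (θ - θ₀))
  rw [hN, hD, hpm, smul_smul]
  have hvp : v ^ p ≠ 0 := by positivity
  have e1 : (v ^ p * Z)⁻¹ * (v ^ p * v) = v * Z⁻¹ := by field_simp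
  rw [e1, mul_smul, smul_sub Z⁻¹, smul_smul Z⁻¹ Z, inv_mul_cancel₀ hZ0, one_smul]

end Posterior

/-- Along sequences on which the rescaled covariances converge uniformly and the rescaled summary
converges, the rescaled posterior mean converges to the generalized least squares estimate. -/
theorem tendsto_smul_posteriorMean_sub {d p : ℕ} {Θ : Set (Vec p)} {prior : Vec p → ℝ}
    {b : Vec p → Vec d} {θ₀ : Vec p} {D : Vec p →L[ℝ] Vec d} {J : Matrix (Fin d) (Fin p) ℝ}
    {v : ℕ → ℝ} {A : ℕ → Vec p → Matrix (Fin d) (Fin d) ℝ} {M₀ : Matrix (Fin d) (Fin d) ℝ}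
    {s : ℕ → Vec d} {x₀ : Vec d} {c₁ c₂ : ℝ} {m : Vec p}
    (hprior : IsPriorDensity Θ prior) (hmom : IntegrableOn (fun θ => ‖θ‖ * prior θ) Θ)
    (hpc : ContinuousAt prior θ₀) (hpp : 0 < prior θ₀) (hθ₀ : θ₀ ∈ interior Θ)
    (hbm : Measurable b) (hb : HasFDerivAt b D θ₀) (hD : ∀ t, (D t).ofLp = J *ᵥ t.ofLp)
    (hJ : Function.Injective J.mulVec)
    (hid : ∀ δ : ℝ, 0 < δ → ∃ ε : ℝ, 0 < ε ∧ ∀ θ ∈ Θ, ‖b θ - b θ₀‖ < ε → ‖θ - θ₀‖ < δ)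
    (hv : ∀ k, 0 < v k) (hvt : Tendsto v atTop atTop)
    (hA : ∀ k i j, Measurable fun θ => A k θ i j) (hc₁ : 0 < c₁) (hc₂ : 0 < c₂)
    (hE : ∀ k, ∀ θ ∈ Θ, EigenvaluesIn c₁ c₂ (v k ^ 2 • ((A k θ)ᵀ * A k θ)))
    (hM₀ : M₀.PosDef)
    (hM : Tendsto (fun q : ℕ × Vec p => v q.1 ^ 2 • ((A q.1 q.2)ᵀ * A q.1 q.2))
      (atTop ×ˢ 𝓝 θ₀) (𝓝 M₀))
    (hx : Tendsto (fun k => v k • (s k - b θ₀)) atTop (𝓝 x₀))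
    (hm : m.ofLp = ((Jᵀ * M₀⁻¹ * J)⁻¹ * (Jᵀ * M₀⁻¹)) *ᵥ x₀.ofLp) :
    Tendsto (fun k => v k • (posteriorMean Θ prior b (A k) (s k) - θ₀)) atTop (𝓝 m) := by
  have hDi : Function.Injective D := fun t t' h => by
    have h1 : J *ᵥ t.ofLp = J *ᵥ t'.ofLp := by rw [← hD, ← hD, h]
    exact WithLp.ofLp_injective 2 (hJ h1)
  have hex : ∀ k, PosteriorMeanExists Θ prior b (A k) (s k) := fun k =>
    posteriorMeanExists_of_eigenvaluesIn hprior hmom hbm (hA k) (hv k) hc₁ hc₂ (hE k) _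
  have hMm : ∀ k i j, Measurable fun θ => (v k ^ 2 • ((A k θ)ᵀ * A k θ)) i j := fun k =>
    measurable_smul_transpose_mul_self (hA k) _
  have hMh : ∀ k θ, (v k ^ 2 • ((A k θ)ᵀ * A k θ)).IsHermitian := fun k θ =>
    isHermitian_smul_transpose_mul_self _ _
  have hN := tendsto_rescaled_integral (φ := fun t : Vec p => t) hprior.measurableSet
    hprior.measurable hprior.nonneg hprior.integrableOn hmom hpc hθ₀ hbm hb hDi hid hv hvt hMm hc₁
    hc₂ hMh hE hM₀.det_pos hM hx continuous_id (fun t => by simp)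
  have hZ := tendsto_rescaled_integral (φ := fun _ : Vec p => (1 : ℝ)) hprior.measurableSet
    hprior.measurable hprior.nonneg hprior.integrableOn hmom hpc hθ₀ hbm hb hDi hid hv hvt hMm hc₁
    hc₂ hMh hE hM₀.det_pos hM hx continuous_const (fun t => by simp)
  simp only [smul_posteriorMean_sub (hex _) (hv _)]
  have hI := integral_gaussKernel_pos hM₀ hDi x₀
  have eN : ∫ t : Vec p, (gaussKernel M₀ (x₀ - D t) * prior θ₀) • t =
      (prior θ₀ * ∫ t : Vec p, gaussKernel M₀ (x₀ - D t)) • m := by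
    rw [mul_smul, ← integral_gaussKernel_smul_id hM₀ hJ hD hDi x₀ hm, ← integral_smul]
    simp only [smul_smul, mul_comm]
  have eZ : ∫ t : Vec p, (gaussKernel M₀ (x₀ - D t) * prior θ₀) • (1 : ℝ) =
      prior θ₀ * ∫ t : Vec p, gaussKernel M₀ (x₀ - D t) := by
    simp only [smul_eq_mul, mul_one]
    rw [integral_mul_const, mul_comm]
  rw [eN] at hN
  rw [eZ] at hZ
  have hpos : prior θ₀ * ∫ t : Vec p, gaussKernel M₀ (x₀ - D t) ≠ 0 := (mul_pos hpp hI).ne'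
  have := (hZ.inv₀ hpos).smul hN
  rwa [inv_smul_smul₀ hpos] at this

end SynthLik

namespace SynthLik

section Probability

/-- The linear map on Euclidean spaces given by a matrix. -/
noncomputable def mulVecCLM {m n : ℕ} (L : Matrix (Fin m) (Fin n) ℝ) : Vec n →L[ℝ] Vec m :=
  LinearMap.toContinuousLinearMap (Matrix.toEuclideanLin L)

lemma ofLp_mulVecCLM {m n : ℕ} (L : Matrix (Fin m) (Fin n) ℝ) (x : Vec n) :
    (mulVecCLM L x).ofLp = L *ᵥ x.ofLp := rfl

lemma real_inner_eq_dotProduct {k : ℕ} (x y : Vec k) : inner ℝ x y = x.ofLp ⬝ᵥ y.ofLp := by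
  simp [PiLp.inner_apply, dotProduct, mul_comm]

lemma map_multivariateGaussian_mulVecCLM {m n : ℕ} (L : Matrix (Fin m) (Fin n) ℝ)
    {V : Matrix (Fin n) (Fin n) ℝ} (hV : V.PosSemidef) :
    (multivariateGaussian 0 V).map (mulVecCLM L) = multivariateGaussian 0 (L * V * Lᵀ) := by
  have hV' : (L * V * Lᵀ).PosSemidef := by
    have := hV.mul_mul_conjTranspose_same L
    rwa [conjTranspose_eq_transpose_of_trivial] at this
  have : IsProbabilityMeasure ((multivariateGaussian 0 V).map (mulVecCLM L)) :=
    Measure.isProbabilityMeasure_map (mulVecCLM L).continuous.measurable.aemeasurable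
  refine Measure.ext_of_charFun (funext fun t => ?_)
  set u : Vec n := WithLp.toLp 2 (Lᵀ *ᵥ t.ofLp) with hu
  have hL : ∀ x, inner ℝ (mulVecCLM L x) t = inner ℝ x u := fun x => by
    rw [real_inner_eq_dotProduct, real_inner_eq_dotProduct, ofLp_mulVecCLM, hu,
      dotProduct_comm x.ofLp, mulVec_transpose, ← dotProduct_mulVec, dotProduct_comm]
  have h1 : charFun ((multivariateGaussian 0 V).map (mulVecCLM L)) t =
      charFun (multivariateGaussian 0 V) u := by
    rw [charFun_apply, charFun_apply, integral_map (mulVecCLM L).continuous.aemeasurable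
      (by fun_prop)]
    simp only [hL]
  rw [h1, charFun_multivariateGaussian hV, charFun_multivariateGaussian hV']
  congr 3
  · simp
  · rw [hu, ← mulVec_mulVec, ← mulVec_mulVec, dotProduct_mulVec t.ofLp L, ← mulVec_transpose]

lemma posSemidef_varMatrix {Ω : Type*} [MeasurableSpace Ω] {P : Measure Ω}
    [IsProbabilityMeasure P] {d : ℕ} {X : Ω → Vec d} (hX : MemLp X 2 P) :
    (varMatrix X P).PosSemidef := by
  have hXi : ∀ i, MemLp (fun ω => X ω i) 2 P := fun i =>
    (EuclideanSpace.proj i : Vec d →L[ℝ] ℝ).comp_memLp' hX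
  refine PosSemidef.of_dotProduct_mulVec_nonneg ?_ fun a => ?_
  · ext i j
    simp only [varMatrix, conjTranspose_apply, of_apply, star_trivial]
    exact covariance_comm _ _
  · have h := covariance_fun_sum_fun_sum (μ := P) (X := fun i ω => a i * X ω i)
      (Y := fun i ω => a i * X ω i) (fun i => (hXi i).const_mul _) (fun i => (hXi i).const_mul _)
    have hnn : 0 ≤ cov[fun ω => ∑ i, a i * X ω i, fun ω => ∑ i, a i * X ω i; P] := by
      rw [covariance_self]
      · exact variance_nonneg _ _
      · exact (Finset.aestronglyMeasurable_fun_sum _ fun i _ =>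
          ((hXi i).const_mul _).aestronglyMeasurable).aemeasurable
    rw [h] at hnn
    refine hnn.trans_eq ?_
    simp only [star_trivial, dotProduct, mulVec, varMatrix, of_apply, Finset.mul_sum,
      covariance_const_mul_left, covariance_const_mul_right]
    exact Finset.sum_congr rfl fun i _ => Finset.sum_congr rfl fun j _ => by ring

lemma PosSemidef.of_tendsto {d : ℕ} {ι : Type*} {l : Filter ι} [l.NeBot]
    {F : ι → Matrix (Fin d) (Fin d) ℝ} {V : Matrix (Fin d) (Fin d) ℝ}
    (hF : Tendsto F l (𝓝 V)) (h : ∀ᶠ i in l, (F i).PosSemidef) : V.PosSemidef := by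
  refine PosSemidef.of_dotProduct_mulVec_nonneg ?_ fun a => ?_
  · have h1 : Tendsto (fun i => (F i)ᴴ) l (𝓝 Vᴴ) :=
      (Continuous.matrix_conjTranspose continuous_id).continuousAt.tendsto.comp hF
    refine tendsto_nhds_unique h1 (hF.congr' ?_)
    filter_upwards [h] with i hi
    exact hi.1.eq.symm
  · have hc : Continuous fun N : Matrix (Fin d) (Fin d) ℝ => star a ⬝ᵥ (N *ᵥ a) := by fun_prop
    refine ge_of_tendsto (hc.continuousAt.tendsto.comp hF) ?_
    filter_upwards [h] with i hi
    exact hi.dotProduct_mulVec_nonneg a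

variable {Ω : ℕ → Type*} [∀ n, MeasurableSpace (Ω n)] {P : ∀ n, Measure (Ω n)}
  [∀ n, IsProbabilityMeasure (P n)]

/-- Variables that converge in distribution are bounded in probability. -/
lemma exists_eventually_measure_norm_gt_lt {k : ℕ} {X : ∀ n, Ω n → Vec k} {μ : Measure (Vec k)}
    [IsProbabilityMeasure μ] (h : TendstoInDistribution X atTop (id : Vec k → Vec k) P μ)
    {τ : ℝ≥0∞} (hτ : 0 < τ) :
    ∃ K : ℝ, ∀ᶠ n in atTop, P n {ω | K < ‖X n ω‖} < τ := by
  have h1 := tendsto_measure_norm_gt_of_isTightMeasureSet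
    (isTightMeasureSet_singleton_of_innerRegular (μ := μ))
  simp only [Set.mem_singleton_iff, iSup_iSup_eq_left] at h1
  obtain ⟨K, hK⟩ := (h1.eventually_lt_const hτ).exists
  have hcl : IsClosed {x : Vec k | K + 1 ≤ ‖x‖} := isClosed_le continuous_const continuous_norm
  have h2 := ProbabilityMeasure.limsup_measure_closed_le_of_tendsto h.tendsto hcl
  refine ⟨K + 1, ?_⟩
  have h3 : μ {x : Vec k | K + 1 ≤ ‖x‖} < τ :=
    (measure_mono fun x (hx : K + 1 ≤ ‖x‖) => (by linarith : K < ‖x‖)).trans_lt hK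
  simp only [ProbabilityMeasure.coe_mk, Measure.map_id] at h2
  filter_upwards [eventually_lt_of_limsup_lt (h2.trans_lt h3)] with n hn
  rw [Measure.map_apply_of_aemeasurable (h.forall_aemeasurable n) hcl.measurableSet] at hn
  exact (measure_mono fun ω (hω : K + 1 < ‖X n ω‖) => hω.le).trans_lt hn

/-- Slutsky's lemma for variables on varying probability spaces. -/
lemma tendstoInDistribution_of_sub {k : ℕ} {X Y : ∀ n, Ω n → Vec k} {μ : Measure (Vec k)}
    [IsProbabilityMeasure μ] (hXm : ∀ n, Measurable (X n)) (hYm : ∀ n, Measurable (Y n))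
    (h : TendstoInDistribution X atTop (id : Vec k → Vec k) P μ)
    (hXY : ∀ ε : ℝ, 0 < ε → Tendsto (fun n => P n {ω | ε ≤ ‖Y n ω - X n ω‖}) atTop (𝓝 0)) :
    TendstoInDistribution Y atTop (id : Vec k → Vec k) P μ := by
  set Q := Measure.infinitePi P with hQ
  have hmp : ∀ n, MeasurePreserving (Function.eval n) Q (P n) := measurePreserving_eval_infinitePi P
  have hlaw : ∀ (Z : ∀ n, Ω n → Vec k) (_ : ∀ n, Measurable (Z n)) (n : ℕ),
      Q.map (fun ω => Z n (ω n)) = (P n).map (Z n) := fun Z hZ n => by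
    rw [← (hmp n).map_eq, Measure.map_map (hZ n) (hmp n).measurable]; rfl
  have hmeas : ∀ (Z : ∀ n, Ω n → Vec k) (_ : ∀ n, Measurable (Z n)) (n : ℕ),
      AEMeasurable (fun ω : ∀ n, Ω n => Z n (ω n)) Q := fun Z hZ n =>
    ((hZ n).comp (measurable_pi_apply n)).aemeasurable
  have hX' : TendstoInDistribution (fun n (ω : ∀ n, Ω n) => X n (ω n)) atTop
      (id : Vec k → Vec k) (fun _ => Q) μ :=
    { forall_aemeasurable := hmeas X hXm
      aemeasurable_limit := aemeasurable_id
      tendsto := by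
        refine h.tendsto.congr fun n => ?_
        exact Subtype.ext (hlaw X hXm n).symm }
  have hY' := tendstoInDistribution_of_tendstoInMeasure_sub
    (fun n (ω : ∀ n, Ω n) => Y n (ω n)) id hX' (by
      rw [tendstoInMeasure_iff_norm]
      intro ε hε
      refine (hXY ε hε).congr fun n => ?_
      have hs : MeasurableSet {ω | ε ≤ ‖Y n ω - X n ω‖} :=
        measurableSet_le measurable_const ((hYm n).sub (hXm n)).norm
      rw [← (hmp n).measure_preimage hs.nullMeasurableSet]
      simp) (hmeas Y hYm)
  exact
    { forall_aemeasurable := fun n => (hYm n).aemeasurable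
      aemeasurable_limit := aemeasurable_id
      tendsto := by
        refine hY'.tendsto.congr fun n => ?_
        exact Subtype.ext (hlaw Y hYm n) }

/-- Linear images of asymptotically normal vectors are asymptotically normal. -/
lemma tendstoInDistribution_mulVecCLM {m k : ℕ} (L : Matrix (Fin m) (Fin k) ℝ)
    {X : ∀ n, Ω n → Vec k} {V : Matrix (Fin k) (Fin k) ℝ} (hV : V.PosSemidef)
    (h : TendstoInDistribution X atTop (id : Vec k → Vec k) P (multivariateGaussian 0 V)) :
    TendstoInDistribution (fun n ω => mulVecCLM L (X n ω)) atTop (id : Vec m → Vec m) P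
      (multivariateGaussian 0 (L * V * Lᵀ)) := by
  have h1 := h.continuous_comp (mulVecCLM L).continuous
  exact
    { forall_aemeasurable := h1.forall_aemeasurable
      aemeasurable_limit := aemeasurable_id
      tendsto := by
        have h2 := h1.tendsto
        have e : (⟨(multivariateGaussian 0 V).map (mulVecCLM L ∘ id),
            Measure.isProbabilityMeasure_map h1.aemeasurable_limit⟩ : ProbabilityMeasure (Vec m)) =
            ⟨(multivariateGaussian 0 (L * V * Lᵀ)).map id,
              Measure.isProbabilityMeasure_map aemeasurable_id⟩ :=
          Subtype.ext (by
            simp only [Function.comp_id, Measure.map_id]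
            exact map_multivariateGaussian_mulVecCLM L hV)
        rw [e] at h2
        exact h2 }

end Probability

end SynthLik

namespace SynthLik

section Covariance

open scoped Matrix.Norms.L2Operator

/-- The uniform distance on `Θ` between the rescaled covariance and its limit. -/
noncomputable def covDeviation {d p : ℕ} (Θ : Set (Vec p)) (v : ℝ)
    (A B : Vec p → Matrix (Fin d) (Fin d) ℝ) : ℝ≥0∞ :=
  ⨆ θ ∈ Θ, ‖v ^ 2 • ((A θ)ᵀ * A θ) - (B θ)ᵀ * B θ‖ₑ

variable {d p : ℕ} {Θ : Set (Vec p)} {A B : Vec p → Matrix (Fin d) (Fin d) ℝ}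

lemma norm_sub_le_of_covDeviation_le {v η : ℝ} (hη : 0 ≤ η)
    (h : covDeviation Θ v A B ≤ ENNReal.ofReal η) {θ : Vec p} (hθ : θ ∈ Θ) :
    ‖v ^ 2 • ((A θ)ᵀ * A θ) - (B θ)ᵀ * B θ‖ ≤ η := by
  have h1 : ‖v ^ 2 • ((A θ)ᵀ * A θ) - (B θ)ᵀ * B θ‖ₑ ≤ ENNReal.ofReal η :=
    (le_iSup₂ (f := fun θ (_ : θ ∈ Θ) => ‖v ^ 2 • ((A θ)ᵀ * A θ) - (B θ)ᵀ * B θ‖ₑ) θ hθ).trans h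
  rwa [← ofReal_norm, ENNReal.ofReal_le_ofReal_iff hη] at h1

lemma abs_dotProduct_mulVec_le (N : Matrix (Fin d) (Fin d) ℝ) (x : Fin d → ℝ) :
    |x ⬝ᵥ (N *ᵥ x)| ≤ ‖N‖ * (x ⬝ᵥ x) := by
  have h1 := abs_real_inner_le_norm (WithLp.toLp 2 x)
    (toEuclideanCLM (𝕜 := ℝ) N (WithLp.toLp 2 x))
  rw [inner_toEuclideanCLM] at h1
  have h2 := (toEuclideanCLM (n := Fin d) (𝕜 := ℝ) N).le_opNorm (WithLp.toLp 2 x)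
  rw [l2_opNorm_toEuclideanCLM] at h2
  have h3 : x ⬝ᵥ x = ‖WithLp.toLp 2 x‖ ^ 2 := ofLp_dotProduct_self (WithLp.toLp 2 x)
  rw [h3]
  calc _ ≤ _ := h1
    _ ≤ ‖WithLp.toLp 2 x‖ * (‖N‖ * ‖WithLp.toLp 2 x‖) := by gcongr
    _ = _ := by ring

lemma EigenvaluesIn.of_norm_sub_le {c₁ c₂ ε : ℝ} {M N : Matrix (Fin d) (Fin d) ℝ}
    (h : EigenvaluesIn c₁ c₂ N) (hMN : ‖M - N‖ ≤ ε) : EigenvaluesIn (c₁ - ε) (c₂ + ε) M := by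
  intro x
  have h0 : 0 ≤ x ⬝ᵥ x := by simpa using dotProduct_star_self_nonneg x
  have h1 := (abs_dotProduct_mulVec_le (M - N) x).trans (mul_le_mul_of_nonneg_right hMN h0)
  rw [sub_mulVec, dotProduct_sub, abs_le] at h1
  have h2 := h x
  constructor <;> nlinarith

lemma CovarianceConditions.exists_eigenvaluesIn {Ω : ℕ → Type*} [∀ n, MeasurableSpace (Ω n)]
    {P : ∀ n, Measure (Ω n)} [∀ n, IsProbabilityMeasure (P n)] {v : ℕ → ℝ}
    {A : ∀ n, Ω n → Vec p → Matrix (Fin d) (Fin d) ℝ} (h : CovarianceConditions P Θ v A B) :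
    ∃ c₁ c₂ : ℝ, 0 < c₁ ∧ 0 < c₂ ∧ ∀ θ ∈ Θ, EigenvaluesIn c₁ c₂ ((B θ)ᵀ * B θ) := by
  obtain ⟨c₁, c₂, hc₁, hc₁₂, hE⟩ := h.eigenvalues
  refine ⟨c₁, c₂, hc₁, hc₁.trans_le hc₁₂, fun θ hθ => ?_⟩
  have key : ∀ ε : ℝ, 0 < ε → EigenvaluesIn (c₁ - ε) (c₂ + ε) ((B θ)ᵀ * B θ) := fun ε hε => by
    have h1 := (hE θ hθ).add (h.uniform_tendsto (ENNReal.ofReal ε) (ENNReal.ofReal_pos.2 hε))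
    rw [add_zero] at h1
    obtain ⟨n, hn⟩ := (h1.eventually_lt_const (zero_lt_one : (0 : ℝ≥0∞) < 1)).exists
    have hne : (({ω | ¬ EigenvaluesIn c₁ c₂ (v n ^ 2 • ((A n ω θ)ᵀ * A n ω θ))} ∪
        {ω | ENNReal.ofReal ε ≤ covDeviation Θ (v n) (A n ω) B}) : Set (Ω n)) ≠ Set.univ := by
      intro hu
      have h2 := (measure_union_le (μ := P n) _ _).trans_lt hn
      have h3 : P n (({ω | ¬ EigenvaluesIn c₁ c₂ (v n ^ 2 • ((A n ω θ)ᵀ * A n ω θ))} ∪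
        {ω | ENNReal.ofReal ε ≤ covDeviation Θ (v n) (A n ω) B}) : Set (Ω n)) < 1 := h2
      rw [hu, measure_univ] at h3
      exact lt_irrefl _ h3
    obtain ⟨ω, hω⟩ := (Set.ne_univ_iff_exists_notMem _).1 hne
    simp only [Set.mem_union, Set.mem_ofPred_eq, not_or, not_not, not_le] at hω
    refine hω.1.of_norm_sub_le ?_
    rw [norm_sub_rev]
    exact norm_sub_le_of_covDeviation_le hε.le hω.2.le hθ
  intro x
  have h0 : 0 ≤ x ⬝ᵥ x := by simpa using dotProduct_star_self_nonneg x
  constructor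
  · refine le_of_forall_pos_le_add fun ε hε => ?_
    have h1 := (key (ε / (1 + x ⬝ᵥ x)) (by positivity) x).1
    have h2 : ε / (1 + x ⬝ᵥ x) * (x ⬝ᵥ x) ≤ ε := by
      rw [div_mul_eq_mul_div, div_le_iff₀ (by positivity)]; nlinarith
    linarith
  · refine le_of_forall_pos_le_add fun ε hε => ?_
    have h1 := (key (ε / (1 + x ⬝ᵥ x)) (by positivity) x).2
    have h2 : ε / (1 + x ⬝ᵥ x) * (x ⬝ᵥ x) ≤ ε := by
      rw [div_mul_eq_mul_div, div_le_iff₀ (by positivity)]; nlinarith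
    linarith

/-- Once the sample size is large and the rescaled covariances are uniformly close to their limit,
the rescaled posterior mean is close to the generalized least squares estimate, uniformly over
bounded values of the rescaled summary. -/
theorem exists_tolerance {prior : Vec p → ℝ} {b : Vec p → Vec d} {θ₀ : Vec p}
    {D : Vec p →L[ℝ] Vec d} {J : Matrix (Fin d) (Fin p) ℝ} {v : ℕ → ℝ} {c₁ c₂ : ℝ}
    (hprior : IsPriorDensity Θ prior) (hmom : IntegrableOn (fun θ => ‖θ‖ * prior θ) Θ)
    (hpc : ContinuousAt prior θ₀) (hpp : 0 < prior θ₀) (hθ₀ : θ₀ ∈ interior Θ)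
    (hbm : Measurable b) (hb : HasFDerivAt b D θ₀) (hD : ∀ t, (D t).ofLp = J *ᵥ t.ofLp)
    (hJ : Function.Injective J.mulVec)
    (hid : ∀ δ : ℝ, 0 < δ → ∃ ε : ℝ, 0 < ε ∧ ∀ θ ∈ Θ, ‖b θ - b θ₀‖ < ε → ‖θ - θ₀‖ < δ)
    (hv : ∀ k, 0 < v k) (hvt : Tendsto v atTop atTop) (hc₁ : 0 < c₁) (hc₂ : 0 < c₂)
    (hB : ∀ θ ∈ Θ, EigenvaluesIn c₁ c₂ ((B θ)ᵀ * B θ)) (hBc : ContinuousAt B θ₀)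
    (K : ℝ) {ε : ℝ} (hε : 0 < ε) :
    ∃ η : ℝ, 0 < η ∧ ∃ N : ℕ, ∀ n ≥ N, ∀ (A : Vec p → Matrix (Fin d) (Fin d) ℝ) (s : Vec d),
      (∀ i j, Measurable fun θ => A θ i j) →
      covDeviation Θ (v n) A B ≤ ENNReal.ofReal η → ‖v n • (s - b θ₀)‖ ≤ K →
      ‖v n • (posteriorMean Θ prior b A s - θ₀) -
        mulVecCLM ((Jᵀ * ((B θ₀)ᵀ * B θ₀)⁻¹ * J)⁻¹ * (Jᵀ * ((B θ₀)ᵀ * B θ₀)⁻¹))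
          (v n • (s - b θ₀))‖ < ε := by
  set M₀ := (B θ₀)ᵀ * B θ₀ with hM₀
  set L := (Jᵀ * M₀⁻¹ * J)⁻¹ * (Jᵀ * M₀⁻¹) with hL
  have hΘ : Θ ∈ 𝓝 θ₀ := mem_interior_iff_mem_nhds.1 hθ₀
  have hM₀p : M₀.PosDef := (hB θ₀ (mem_of_mem_nhds hΘ)).posDef
    (by simpa using isHermitian_smul_transpose_mul_self (B θ₀) 1) hc₁
  by_contra hcon
  push Not at hcon
  have hη : ∀ k : ℕ, 0 < c₁ / 2 / ((k : ℝ) + 1) := fun k => by positivity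
  choose n hn A s hA hdev hs hfar using fun k : ℕ => hcon _ (hη k) k
  obtain ⟨x₀, -, ψ, hψ, hx⟩ := (isCompact_closedBall (0 : Vec d) K).tendsto_subseq
    (x := fun k => v (n k) • (s k - b θ₀)) (fun k => by simpa using hs k)
  have hnt : Tendsto (fun k => n (ψ k)) atTop atTop :=
    tendsto_atTop_mono (fun k => (hψ.id_le k).trans (hn (ψ k))) tendsto_id
  have hclose : ∀ k, ∀ θ ∈ Θ, ‖v (n k) ^ 2 • ((A k θ)ᵀ * A k θ) - (B θ)ᵀ * B θ‖ ≤
      c₁ / 2 / ((k : ℝ) + 1) := fun k θ hθ =>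
    norm_sub_le_of_covDeviation_le (hη k).le (hdev k) hθ
  have hE : ∀ k, ∀ θ ∈ Θ, EigenvaluesIn (c₁ / 2) (c₂ + c₁ / 2)
      (v (n k) ^ 2 • ((A k θ)ᵀ * A k θ)) := fun k θ hθ => by
    have h1 := (hB θ hθ).of_norm_sub_le (ε := c₁ / 2) ((hclose k θ hθ).trans
      (div_le_self (by positivity) (by linarith [k.cast_nonneg (α := ℝ)])))
    rwa [sub_half] at h1
  have hM : Tendsto (fun q : ℕ × Vec p => v (n (ψ q.1)) ^ 2 • ((A (ψ q.1) q.2)ᵀ * A (ψ q.1) q.2))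
      (atTop ×ˢ 𝓝 θ₀) (𝓝 M₀) := by
    have h1 : Tendsto (fun q : ℕ × Vec p => (B q.2)ᵀ * B q.2) (atTop ×ˢ 𝓝 θ₀) (𝓝 M₀) := by
      have hBt : Tendsto (fun q : ℕ × Vec p => B q.2) (atTop ×ˢ 𝓝 θ₀) (𝓝 (B θ₀)) :=
        hBc.tendsto.comp tendsto_snd
      have hc : Continuous fun N : Matrix (Fin d) (Fin d) ℝ => Nᵀ * N := by fun_prop
      exact hc.continuousAt.tendsto.comp hBt
    have h2 : Tendsto (fun q : ℕ × Vec p => v (n (ψ q.1)) ^ 2 •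
        ((A (ψ q.1) q.2)ᵀ * A (ψ q.1) q.2) - (B q.2)ᵀ * B q.2) (atTop ×ˢ 𝓝 θ₀) (𝓝 0) := by
      have h3 : Tendsto (fun q : ℕ × Vec p => c₁ / 2 / ((ψ q.1 : ℝ) + 1)) (atTop ×ˢ 𝓝 θ₀)
          (𝓝 0) := by
        have h4 : Tendsto (fun k : ℕ => c₁ / 2 / ((k : ℝ) + 1)) atTop (𝓝 0) :=
          tendsto_const_div_atTop_nhds_zero_nat (c₁ / 2) |>.comp (tendsto_add_atTop_nat 1) |>.congr
            fun k => by simp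
        exact h4.comp (hψ.tendsto_atTop.comp tendsto_fst)
      refine squeeze_zero_norm' ?_ h3
      have h5 : ∀ᶠ q : ℕ × Vec p in atTop ×ˢ 𝓝 θ₀, q.2 ∈ Θ := tendsto_snd.eventually hΘ
      filter_upwards [h5] with q hq
      exact hclose (ψ q.1) q.2 hq
    simpa using h2.add h1
  have hlim := tendsto_smul_posteriorMean_sub (m := mulVecCLM L x₀) hprior hmom hpc hpp hθ₀ hbm hb
    hD hJ hid (v := fun k => v (n (ψ k))) (A := fun k => A (ψ k)) (s := fun k => s (ψ k))
    (fun k => hv _) (hvt.comp hnt) (fun k => hA _) (half_pos hc₁) (by positivity)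
    (fun k => hE (ψ k)) hM₀p hM hx rfl
  have hL' := ((mulVecCLM L).continuous.tendsto x₀).comp hx
  have h0 := (hlim.sub hL').norm
  rw [sub_self, norm_zero] at h0
  obtain ⟨k, hk⟩ := (h0.eventually_lt_const hε).exists
  exact absurd hk (not_lt.2 (hfar (ψ k)))

end Covariance

end SynthLik

namespace SynthLik

section Congruence

variable {d p : ℕ} {Θ : Set (Vec p)} {prior : Vec p → ℝ} {b b' : Vec p → Vec d}
  {A : Vec p → Matrix (Fin d) (Fin d) ℝ} {s : Vec d}

lemma evidence_congr (hΘ : MeasurableSet Θ) (h : Set.EqOn b b' Θ) :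
    evidence Θ prior b A s = evidence Θ prior b' A s :=
  setIntegral_congr_fun hΘ fun θ hθ => by simp only [synLik, h hθ]

lemma posteriorDensity_congr (hΘ : MeasurableSet Θ) (h : Set.EqOn b b' Θ) :
    Set.EqOn (posteriorDensity Θ prior b A s) (posteriorDensity Θ prior b' A s) Θ := fun θ hθ => by
  simp only [posteriorDensity, evidence_congr hΘ h, synLik, h hθ]

lemma posteriorMean_congr (hΘ : MeasurableSet Θ) (h : Set.EqOn b b' Θ) :
    posteriorMean Θ prior b A s = posteriorMean Θ prior b' A s :=
  setIntegral_congr_fun hΘ fun θ hθ => by simp only [posteriorDensity_congr hΘ h hθ]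

lemma PosteriorMeanExists.congr (hΘ : MeasurableSet Θ) (h : Set.EqOn b b' Θ)
    (he : PosteriorMeanExists Θ prior b A s) : PosteriorMeanExists Θ prior b' A s := by
  refine ⟨he.1.congr_fun (fun θ hθ => ?_) hΘ, evidence_congr hΘ h ▸ he.2.1,
    he.2.2.congr_fun (fun θ hθ => ?_) hΘ⟩
  · simp only [synLik, h hθ]
  · simp only [posteriorDensity_congr hΘ h hθ]

end Congruence

lemma ofLp_fderiv_eq_jacobian_mulVec {d p : ℕ} (b : Vec p → Vec d) (θ t : Vec p) :
    (fderiv ℝ b θ t).ofLp = jacobian b θ *ᵥ t.ofLp := by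
  have ht : t = ∑ j, t j • EuclideanSpace.single j (1 : ℝ) := by
    simpa using ((EuclideanSpace.basisFun (Fin p) ℝ).sum_repr t).symm
  ext i
  conv_lhs => rw [ht]
  simp [map_sum, mulVec, dotProduct, jacobian, mul_comm]

lemma mulVec_injective_of_rank_eq {d p : ℕ} {J : Matrix (Fin d) (Fin p) ℝ} (h : J.rank = p) :
    Function.Injective J.mulVec := by
  have h1 := LinearMap.finrank_range_add_finrank_ker J.mulVecLin
  rw [Module.finrank_fin_fun] at h1
  have h2 : Module.finrank ℝ (LinearMap.range J.mulVecLin) = p := h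
  have h3 : Module.finrank ℝ (LinearMap.ker J.mulVecLin) = 0 := by omega
  exact LinearMap.ker_eq_bot.1 (Submodule.finrank_eq_zero.1 h3)

lemma sandwich_eq {d p : ℕ} (J : Matrix (Fin d) (Fin p) ℝ) (B₀ V : Matrix (Fin d) (Fin d) ℝ) :
    ((Jᵀ * (B₀ᵀ * B₀)⁻¹ * J)⁻¹ * (Jᵀ * (B₀ᵀ * B₀)⁻¹)) * V *
      ((Jᵀ * (B₀ᵀ * B₀)⁻¹ * J)⁻¹ * (Jᵀ * (B₀ᵀ * B₀)⁻¹))ᵀ = sandwich J B₀ V := by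
  simp only [sandwich, W, transpose_mul, transpose_nonsing_inv, transpose_transpose,
    Matrix.mul_assoc]

lemma SummaryCLT.posSemidef {Ω : ℕ → Type*} [∀ n, MeasurableSpace (Ω n)]
    {P : ∀ n, Measure (Ω n)} [∀ n, IsProbabilityMeasure (P n)] {d : ℕ} {T : ∀ n, Ω n → Vec d}
    {v : ℕ → ℝ} {b₀ : Vec d} {V₀ : Matrix (Fin d) (Fin d) ℝ} (h : SummaryCLT P T v b₀ V₀) :
    V₀.PosSemidef := by
  refine PosSemidef.of_tendsto h.var_tendsto ?_
  filter_upwards [h.memLp] with n hn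
  exact posSemidef_varMatrix ((hn.sub (memLp_const b₀)).const_smul (v n))

/-- The posterior mean is asymptotically normal when the mean map is measurable everywhere. -/
theorem posteriorMean_asymptoticNormality {d p : ℕ} {Ω : ℕ → Type*} [∀ n, MeasurableSpace (Ω n)]
    {P : ∀ n, Measure (Ω n)} [∀ n, IsProbabilityMeasure (P n)] {T : ∀ n, Ω n → Vec d}
    (hT : ∀ n, Measurable (T n)) {Θ : Set (Vec p)} {prior : Vec p → ℝ}
    (hprior : IsPriorDensity Θ prior) {b : Vec p → Vec d}
    {A : ∀ n, Ω n → Vec p → Matrix (Fin d) (Fin d) ℝ} {B : Vec p → Matrix (Fin d) (Fin d) ℝ}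
    {v : ℕ → ℝ} {V₀ : Matrix (Fin d) (Fin d) ℝ} {θ₀ : Vec p} {D : Vec p →L[ℝ] Vec d}
    {J : Matrix (Fin d) (Fin p) ℝ}
    (hS : SummaryCLT P T v (b θ₀) V₀) (hC : CovarianceConditions P Θ v A B)
    (hbm : Measurable b) (hb : HasFDerivAt b D θ₀) (hD : ∀ t, (D t).ofLp = J *ᵥ t.ofLp)
    (hJ : Function.Injective J.mulVec) (hθ₀ : θ₀ ∈ interior Θ)
    (hid : ∀ δ : ℝ, 0 < δ → ∃ ε : ℝ, 0 < ε ∧ ∀ θ ∈ Θ, ‖b θ - b θ₀‖ < ε → ‖θ - θ₀‖ < δ)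
    (hpc : ContinuousAt prior θ₀) (hpp : 0 < prior θ₀)
    (hmom : IntegrableOn (fun θ => ‖θ‖ * prior θ) Θ) :
    Tendsto (fun n => P n {ω | ¬ PosteriorMeanExists Θ prior b (A n ω) (T n ω)}) atTop (𝓝 0) ∧
    TendstoInDistribution
      (fun n ω => v n • (posteriorMean Θ prior b (A n ω) (T n ω) - θ₀)) atTop
      (id : Vec p → Vec p) P (multivariateGaussian 0 (sandwich J (B θ₀) V₀)) := by
  obtain ⟨c₁, c₂, hc₁, hc₂, hB⟩ := hC.exists_eigenvaluesIn
  have hAm : ∀ n ω i j, Measurable fun θ => A n ω θ i j := fun n ω i j =>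
    (hC.measurable n i j).comp measurable_prodMk_left
  have hBc : ContinuousAt B θ₀ :=
    hC.uniformContinuousOn.continuousOn.continuousAt (mem_interior_iff_mem_nhds.1 hθ₀)
  have hdev : ∀ η : ℝ, 0 < η →
      Tendsto (fun n => P n {ω | ENNReal.ofReal η ≤ covDeviation Θ (v n) (A n ω) B}) atTop (𝓝 0) :=
    fun η hη => hC.uniform_tendsto _ (ENNReal.ofReal_pos.2 hη)
  constructor
  · refine tendsto_of_tendsto_of_tendsto_of_le_of_le tendsto_const_nhds
      (hdev (c₁ / 2) (half_pos hc₁)) (fun _ => zero_le) fun n => measure_mono fun ω hω => ?_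
    by_contra hlt
    refine hω (posteriorMeanExists_of_eigenvaluesIn (c₁ := c₁ / 2) (c₂ := c₂ + c₁ / 2) hprior hmom
      hbm (hAm n ω) (hS.rate_pos n) (half_pos hc₁) (by positivity) (fun θ hθ => ?_) _)
    have h1 := (hB θ hθ).of_norm_sub_le
      (norm_sub_le_of_covDeviation_le (half_pos hc₁).le (not_le.1 hlt).le hθ)
    rwa [sub_half] at h1
  · set L := (Jᵀ * ((B θ₀)ᵀ * B θ₀)⁻¹ * J)⁻¹ * (Jᵀ * ((B θ₀)ᵀ * B θ₀)⁻¹) with hL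
    have hlin := tendstoInDistribution_mulVecCLM L hS.posSemidef hS.clt
    rw [hL, sandwich_eq, ← hL] at hlin
    have hXm : ∀ n, Measurable fun ω => v n • (T n ω - b θ₀) := fun n =>
      ((hT n).sub_const _).const_smul (v n)
    refine tendstoInDistribution_of_sub
      (fun n => (mulVecCLM L).continuous.measurable.comp (hXm n)) (fun n => ?_) hlin ?_
    · exact ((measurable_posteriorMean (hC.measurable n) (hT n) hbm hprior.measurable).sub_const
        _).const_smul (v n)
    · intro ε hε
      rw [ENNReal.tendsto_nhds_zero]
      intro τ hτ
      obtain ⟨K, hK⟩ := exists_eventually_measure_norm_gt_lt hS.clt (ENNReal.half_pos hτ.ne')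
      obtain ⟨η, hη, N, hN⟩ := exists_tolerance hprior hmom hpc hpp hθ₀ hbm hb hD hJ hid hS.rate_pos
        hS.rate_tendsto hc₁ hc₂ hB hBc K hε
      filter_upwards [hK, (hdev η hη).eventually_lt_const (ENNReal.half_pos hτ.ne'),
        eventually_ge_atTop N] with n h1 h2 h3
      calc _ ≤ P n ({ω | K < ‖v n • (T n ω - b θ₀)‖} ∪
            {ω | ENNReal.ofReal η ≤ covDeviation Θ (v n) (A n ω) B}) := by
            refine measure_mono fun ω hω => ?_
            by_contra hnot
            simp only [Set.mem_union, Set.mem_ofPred_eq, not_or, not_lt, not_le] at hnot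
            exact absurd (hN n h3 (A n ω) (T n ω) (hAm n ω) hnot.2.le hnot.1) (not_lt.2 hω)
        _ ≤ _ := measure_union_le _ _
        _ ≤ τ / 2 + τ / 2 := add_le_add h1.le h2.le
        _ = τ := ENNReal.add_halves τ

end SynthLik

open SynthLik in
theorem corollary1
    {d p : ℕ}
    {Ω : ℕ → Type*} [∀ n, MeasurableSpace (Ω n)]
    (P : ∀ n, Measure (Ω n)) [∀ n, IsProbabilityMeasure (P n)]
    (y : ∀ n, Ω n → Vec n) (hy : ∀ n, Measurable (y n))
    (S : ∀ n, Vec n → Vec d) (hS : ∀ n, Measurable (S n))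
    (Θ : Set (Vec p)) (prior : Vec p → ℝ) (hprior : IsPriorDensity Θ prior)
    (b : Vec p → Vec d)
    (A : ∀ n, Ω n → Vec p → Matrix (Fin d) (Fin d) ℝ)
    (B : Vec p → Matrix (Fin d) (Fin d) ℝ)
    (v : ℕ → ℝ) (b₀ : Vec d) (V₀ : Matrix (Fin d) (Fin d) ℝ) (θ₀ : Vec p)
    (h_summary : SummaryCLT P (fun n ω => S n (y n ω)) v b₀ V₀)
    (h_cov : CovarianceConditions P Θ v A B)
    (h_mean : MeanMapConditions Θ b θ₀ b₀)
    (h_prior : PriorConditions prior θ₀)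
    (h_moment : IntegrableOn (fun θ => ‖θ‖ * prior θ) Θ) :
    Tendsto
      (fun n => P n {ω | ¬ PosteriorMeanExists Θ prior b (A n ω) (S n (y n ω))})
      atTop (𝓝 0) ∧
    TendstoInDistribution
      (fun n ω => v n • (posteriorMean Θ prior b (A n ω) (S n (y n ω)) - θ₀)) atTop
      (id : Vec p → Vec p) P
      (multivariateGaussian 0 (sandwich (jacobian b θ₀) (B θ₀) V₀)) := by
  set b' : Vec p → Vec d := Θ.indicator b with hb'
  have hΘ := hprior.measurableSet
  have hΘn : Θ ∈ 𝓝 θ₀ := mem_interior_iff_mem_nhds.1 h_mean.mem_interior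
  have heq : Set.EqOn b b' Θ := fun θ hθ => (Set.indicator_of_mem hθ b).symm
  have hbm : Measurable b' := by
    classical
    rw [hb', ← Set.piecewise_eq_indicator]
    exact h_mean.continuousOn.measurable_piecewise continuousOn_const hΘ
  have hb'₀ : b' θ₀ = b₀ := by rw [← heq (mem_of_mem_nhds hΘn), h_mean.map_eq]
  obtain ⟨δ, hδ, hdiff, -⟩ := h_mean.jacobian_continuous
  obtain ⟨δ', hδ', hpc⟩ := h_prior.continuous_near
  have hderiv : HasFDerivAt b' (fderiv ℝ b θ₀) θ₀ :=
    (hdiff θ₀ (Metric.mem_closedBall_self hδ.le)).hasFDerivAt.congr_of_eventuallyEq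
      (Filter.mem_of_superset hΘn fun θ hθ => (heq hθ).symm)
  have hid : ∀ δ : ℝ, 0 < δ →
      ∃ ε : ℝ, 0 < ε ∧ ∀ θ ∈ Θ, ‖b' θ - b' θ₀‖ < ε → ‖θ - θ₀‖ < δ := fun δ hδ => by
    obtain ⟨ε, hε, h⟩ := h_mean.identified δ hδ
    refine ⟨ε, hε, fun θ hθ hlt => h θ hθ ?_⟩
    rwa [heq hθ, ← hb'₀]
  subst hb'₀
  have main := posteriorMean_asymptoticNormality (fun n => (hS n).comp (hy n)) hprior h_summary
    h_cov hbm hderiv (ofLp_fderiv_eq_jacobian_mulVec b θ₀)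
    (mulVec_injective_of_rank_eq h_mean.full_rank) h_mean.mem_interior hid
    (hpc.continuousAt (Metric.closedBall_mem_nhds θ₀ hδ')) h_prior.pos h_moment
  simp only [posteriorMean_congr hΘ heq]
  refine ⟨?_, main.2⟩
  refine main.1.congr fun n => congrArg _ (Set.ext fun ω => not_congr ?_)
  exact ⟨fun h => h.congr hΘ heq.symm, fun h => h.congr hΘ heq⟩
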